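/- Formulas of first-order arithmetic are built from the symbols $0,1,+,\cdot,<,=$ with the connectives $\neg,\wedge,\vee,\to,\exists,\forall$, all taken as primitive, and are interpreted over $\mathbb N$. For functions $\alpha,\beta,\gamma:\mathbb N\to\mathbb N$ say that $\alpha|\beta$ is defined and equal to $\gamma$ if for every $n$ there is an $m$ such that $\alpha(\langle n,\langle\beta(0),\dots,\beta(m-1)\rangle\rangle)=\gamma(n)+1$ and $\alpha(\langle n,\langle\beta(0),\dots,\beta(k-1)\rangle\rangle)=0$ for all $k<m$, where $\langle\cdot\rangle$ are standard recursive codings. Let $\alpha^{+}(k)=\alpha(k+1)$. The relation "$\alpha$ witnesses $A$" (continuous function realizability), for a formula $A$ with numbers assigned to its free variables, is defined by recursion: - $\alpha$ witnesses an atomic formula iff the formula is true; - $\alpha$ witnesses $\neg A$ iff no function $\beta$ witnesses $A$; - $\alpha$ witnesses $A\wedge B$ iff $k\mapsto\alpha(2k)$ witnesses $A$ and $k\mapsto\alpha(2k+1)$ witnesses $B$; - $\alpha$ witnesses $A\vee B$ iff either $\alpha(0)=0$ and $\alpha^{+}$ witnesses $A$, or $\alpha(0)\ne 0$ and $\alpha^{+}$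 witnesses $B$; - $\alpha$ witnesses $A\to B$ iff for every function $\beta$ witnessing $A$, $\alpha|\beta$ is defined and witnesses $B$; - $\alpha$ witnesses $\exists x\,A(x)$ iff $\alpha^{+}$ witnesses $A(\alpha(0))$; - $\alpha$ witnesses $\forall x\,A(x)$ iff for every $n$ the function $k\mapsto\alpha(\langle n,k\rangle)$ witnesses $A(n)$. An arithmetical sentence is *constructively true* if it is witnessed by some recursive function. A set $S\subseteq\mathbb N$ is $\Pi^1_2$ (respectively $\Sigma^1_2$) if $S=\{n:\forall X\,\exists Y\,\varphi(n,X,Y)\}$ (respectively $S=\{n:\exists X\,\forall Y\,\varphi(n,X,Y)\}$), where $X,Y$ range over subsets of $\mathbb N$ and $\varphi$ is an arithmetical formula in which $X$ and $Y$ may be used as predicates, interpreted classically. **Theorem.** The set of Gödel numbers of constructively true first-order arithmetical sentences is $\Pi^1_2$-hard and $\Sigma^1_2$-hard: every $\Pi^1_2$ set $S\subseteq\mathbb N$, and every $\Sigma^1_2$ set $S\subseteq\mathbb N$, is many-one reducible to it by a recursive function. -/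

import Mathlib

namespace ConstructiveTruth

/-- Terms of the language of arithmetic, with variables `v₀, v₁, …`. -/
inductive Term : Type
  | var (x : ℕ)
  | zero
  | one
  | add (s t : Term)
  | mul (s t : Term)

namespace Term

def eval (e : ℕ → ℕ) : Term → ℕ
  | var x => e x
  | zero => 0
  | one => 1
  | add s t => s.eval e + t.eval e
  | mul s t => s.eval e * t.eval e

def freeVars : Term → Finset ℕ
  | var x => {x}
  | zero => ∅
  | one => ∅
  | add s t => s.freeVars ∪ t.freeVars
  | mul s t => s.freeVars ∪ t.freeVars

/-- Gödel numbers of terms. -/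
def code : Term → ℕ
  | var x => Nat.pair 0 x
  | zero => Nat.pair 1 0
  | one => Nat.pair 2 0
  | add s t => Nat.pair 3 (Nat.pair s.code t.code)
  | mul s t => Nat.pair 4 (Nat.pair s.code t.code)

theorem code_injective : Function.Injective code := by
  intro s
  induction s with
  | var x => intro t h; cases t <;> simp_all [code]
  | zero => intro t h; cases t <;> simp_all [code]
  | one => intro t h; cases t <;> simp_all [code]
  | add a b iha ihb =>
    intro t h
    cases t <;> simp only [code, Nat.pair_eq_pair] at h <;> try omega
    rw [iha h.2.1, ihb h.2.2]
  | mul a b iha ihb =>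
    intro t h
    cases t <;> simp only [code, Nat.pair_eq_pair] at h <;> try omega
    rw [iha h.2.1, ihb h.2.2]

end Term

/-- Formulas with number quantifiers only, in the language `0, 1, +, *, <, =` together with
free set variables indexed by `σ` (which may occur in atoms `t ∈ X`). All connectives are primitive,
since they are not interdefinable constructively. -/
inductive Formula (σ : Type) : Type
  | eq (s t : Term)
  | lt (s t : Term)
  | mem (t : Term) (X : σ)
  | neg (A : Formula σ)
  | and (A B : Formula σ)
  | or (A B : Formula σ)
  | imp (A B : Formula σ)
  | ex (x : ℕ) (A : Formula σ)
  | all (x : ℕ) (A : Formula σ)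

/-- First-order arithmetical formulas: no set variables. -/
abbrev ArithFormula : Type := Formula Empty

namespace Formula

def freeVars {σ : Type} : Formula σ → Finset ℕ
  | eq s t => s.freeVars ∪ t.freeVars
  | lt s t => s.freeVars ∪ t.freeVars
  | mem t _ => t.freeVars
  | neg A => A.freeVars
  | and A B => A.freeVars ∪ B.freeVars
  | or A B => A.freeVars ∪ B.freeVars
  | imp A B => A.freeVars ∪ B.freeVars
  | ex x A => A.freeVars.erase x
  | all x A => A.freeVars.erase x

/-- Classical truth in the standard model, where `I` interprets the set variables
and `e` the number variables. -/
def Holds {σ : Type} (I : σ → Set ℕ) : Formula σ → (ℕ → ℕ) → Prop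
  | eq s t, e => s.eval e = t.eval e
  | lt s t, e => s.eval e < t.eval e
  | mem t X, e => t.eval e ∈ I X
  | neg A, e => ¬ A.Holds I e
  | and A B, e => A.Holds I e ∧ B.Holds I e
  | or A B, e => A.Holds I e ∨ B.Holds I e
  | imp A B, e => A.Holds I e → B.Holds I e
  | ex x A, e => ∃ n : ℕ, A.Holds I (Function.update e x n)
  | all x A, e => ∀ n : ℕ, A.Holds I (Function.update e x n)

/-- Gödel numbers of arithmetical formulas. -/
def code : ArithFormula → ℕ
  | eq s t => Nat.pair 0 (Nat.pair s.code t.code)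
  | lt s t => Nat.pair 1 (Nat.pair s.code t.code)
  | mem _ X => X.elim
  | neg A => Nat.pair 2 A.code
  | and A B => Nat.pair 3 (Nat.pair A.code B.code)
  | or A B => Nat.pair 4 (Nat.pair A.code B.code)
  | imp A B => Nat.pair 5 (Nat.pair A.code B.code)
  | ex x A => Nat.pair 6 (Nat.pair x A.code)
  | all x A => Nat.pair 7 (Nat.pair x A.code)

theorem code_injective : Function.Injective code := by
  intro φ
  induction φ with
  | mem _ X => exact X.elim
  | eq s t =>
    intro ψ h
    rcases ψ with _ | _ | ⟨_, ⟨⟩⟩ | _ | _ | _ | _ | _ | _ <;>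
      simp only [code, Nat.pair_eq_pair] at h <;> try omega
    rw [Term.code_injective h.2.1, Term.code_injective h.2.2]
  | lt s t =>
    intro ψ h
    rcases ψ with _ | _ | ⟨_, ⟨⟩⟩ | _ | _ | _ | _ | _ | _ <;>
      simp only [code, Nat.pair_eq_pair] at h <;> try omega
    rw [Term.code_injective h.2.1, Term.code_injective h.2.2]
  | neg A ih =>
    intro ψ h
    rcases ψ with _ | _ | ⟨_, ⟨⟩⟩ | _ | _ | _ | _ | _ | _ <;>
      simp only [code, Nat.pair_eq_pair] at h <;> try omega
    rw [ih h.2]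
  | and A B ihA ihB | or A B ihA ihB | imp A B ihA ihB =>
    intro ψ h
    rcases ψ with _ | _ | ⟨_, ⟨⟩⟩ | _ | _ | _ | _ | _ | _ <;>
      simp only [code, Nat.pair_eq_pair] at h <;> try omega
    rw [ihA h.2.1, ihB h.2.2]
  | ex x A ih | all x A ih =>
    intro ψ h
    rcases ψ with _ | _ | ⟨_, ⟨⟩⟩ | _ | _ | _ | _ | _ | _ <;>
      simp only [code, Nat.pair_eq_pair] at h <;> try omega
    rw [h.2.1, ih h.2.2]

end Formula

/-- `Applies α β γ`: the function `α`, read as a (code of a) partial continuous functional on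
Baire space, is defined at `β` with value `γ`. To compute `γ n`, feed `α` longer and longer initial
segments of `β` together with `n`; the answer `0` asks for a longer segment, and the first answer
of the form `k + 1` gives the value `k`. -/
def Applies (α β γ : ℕ → ℕ) : Prop :=
  ∀ n : ℕ, ∃ m : ℕ,
    α (Encodable.encode (n, (List.range m).map β)) = γ n + 1 ∧
    ∀ k < m, α (Encodable.encode (n, (List.range k).map β)) = 0

/-- `Witnesses φ e α`: the function `α` witnesses the arithmetical formula `φ`
under the assignment `e` (continuous function realizability). Witnesses of antecedents range over
arbitrary functions, not only recursive ones. -/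
def Witnesses : ArithFormula → (ℕ → ℕ) → (ℕ → ℕ) → Prop
  | .eq s t, e, _ => s.eval e = t.eval e
  | .lt s t, e, _ => s.eval e < t.eval e
  | .mem _ X, _, _ => X.elim
  | .neg A, e, _ => ∀ β : ℕ → ℕ, ¬ Witnesses A e β
  | .and A B, e, α =>
      Witnesses A e (fun k => α (2 * k)) ∧ Witnesses B e (fun k => α (2 * k + 1))
  | .or A B, e, α =>
      (α 0 = 0 ∧ Witnesses A e (fun k => α (k + 1))) ∨
      (α 0 ≠ 0 ∧ Witnesses B e (fun k => α (k + 1)))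
  | .imp A B, e, α =>
      ∀ β : ℕ → ℕ, Witnesses A e β → ∃ γ : ℕ → ℕ, Applies α β γ ∧ Witnesses B e γ
  | .ex x A, e, α => Witnesses A (Function.update e x (α 0)) (fun k => α (k + 1))
  | .all x A, e, α => ∀ n : ℕ, Witnesses A (Function.update e x n) (fun k => α (Nat.pair n k))

/-- An arithmetical formula without free variables (the assignment is then irrelevant) is
constructively true if it has a recursive witness. -/
def ConstructivelyTrue (φ : ArithFormula) : Prop :=
  ∃ α : ℕ → ℕ, Computable α ∧ Witnesses φ (fun _ => 0) α

/-- The set of Gödel numbers of constructively true arithmetical sentences. -/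
def constructiveArithmeticalTruth : Set ℕ :=
  {c | ∃ φ : ArithFormula, φ.freeVars = ∅ ∧ ConstructivelyTrue φ ∧ φ.code = c}

/-- `S` is `Π¹₂`: defined by `∀ X ∃ Y φ(n, X, Y)` with `φ` arithmetical in the sets `X`, `Y`
and with no free number variable other than `v₀`, which stands for `n`. -/
def IsPi12 (S : Set ℕ) : Prop :=
  ∃ φ : Formula (Fin 2), φ.freeVars ⊆ {0} ∧
    ∀ n : ℕ, n ∈ S ↔ ∀ X : Set ℕ, ∃ Y : Set ℕ, φ.Holds ![X, Y] (fun _ => n)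

/-- `S` is `Σ¹₂`: defined by `∃ X ∀ Y φ(n, X, Y)` with `φ` arithmetical in `X`, `Y`. -/
def IsSigma12 (S : Set ℕ) : Prop :=
  ∃ φ : Formula (Fin 2), φ.freeVars ⊆ {0} ∧
    ∀ n : ℕ, n ∈ S ↔ ∃ X : Set ℕ, ∀ Y : Set ℕ, φ.Holds ![X, Y] (fun _ => n)

/-- `T` is hard for a class of sets: every set in the class is many-one reducible to `T`
by a recursive function. -/
def IsHardFor (Γ : Set ℕ → Prop) (T : Set ℕ) : Prop :=
  ∀ S : Set ℕ, Γ S → ManyOneReducible (fun n => n ∈ S) (fun n => n ∈ T)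

end ConstructiveTruth

/-! Skolemizing a truth table of the matrix turns a `Π¹₂` statement into `∀ f, ∃ g, T.Passes a
(interleave f g)`, where `T` is a primitive recursive sequence of tests of three values each
(`exists_testSequence`). Tests ignore the last binary digit of every value, so a function can be
changed to avoid any single entry `p = (j, y)`, that is, `h j = y`, without changing the outcome.

Witnesses of antecedents are arbitrary functions, so `∀ x ∃ y` to the left of an implication acts as
a function quantifier. The obstacle is that the succedent is arithmetical and cannot mention the
function. A hidden forbidden entry `p` gets around this. The basic formula says: given an even part
`f` avoiding `p`, and a refuter that turns every odd part avoiding `p` into a failing test without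
the entry `p`, there is a conflict, namely an answer of the refuter with an entry that disagrees
with `f` or with the segment inspected. Its witnesses are the conflict finders for `p`; their claims
are checked against `p` only.

If every `f` has a passing `g`, a refuter must lie about this `g`, and a search that does not know
`p` finds a lie (`conflictFinder_finder`). If some `f` has no passing `g`, an honest refuter exists.
A finder's answer to it misreports the data, hence is wrong for some forbidden entry which the data
avoid; as the answer depends on finitely many values, this already happens for a finite input
(`exists_not_conflict`).

The forbidden entry is `u a n`, for an arithmetical choice function `u` made by diagonalization. The
sentence for `Π¹₂` asks, for all `n`, for a conflict finder for `u a n`, an entry for which the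
`n`-th recursive candidate errs, if there is one (`exists_pi_family`). The sentence for `Σ¹₂` asks
to name, given any conflict finder for `u a n`, an answer that is right for `u a n` and wrong for
another entry; here `u a n` is the entry that the `n`-th candidate names when applied to the
canonical finder (`exists_sigma_family`). The matrices are doubly negated, so they carry no
information about `u`. -/

namespace ConstructiveTruth

/-! ### Arithmetical definability of the graphs of partial recursive functions. -/

/-- A property of assignments is definable if it is expressed by an arithmetical formula. -/
def Definable (P : (ℕ → ℕ) → Prop) : Prop :=
  ∃ θ : ArithFormula, ∀ e, θ.Holds (fun X => X.elim) e ↔ P e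

namespace Definable

variable {P Q : (ℕ → ℕ) → Prop}

theorem of_iff (h : Definable P) (H : ∀ e, P e ↔ Q e) : Definable Q := by
  obtain ⟨θ, hθ⟩ := h
  exact ⟨θ, fun e => (hθ e).trans (H e)⟩

theorem eq (s t : Term) : Definable fun e => s.eval e = t.eval e := ⟨.eq s t, fun _ => Iff.rfl⟩

theorem lt (s t : Term) : Definable fun e => s.eval e < t.eval e := ⟨.lt s t, fun _ => Iff.rfl⟩

theorem not (h : Definable P) : Definable fun e => ¬ P e := by
  obtain ⟨θ, hθ⟩ := h
  exact ⟨.neg θ, fun e => not_congr (hθ e)⟩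

theorem and (h : Definable P) (h' : Definable Q) : Definable fun e => P e ∧ Q e := by
  obtain ⟨θ, hθ⟩ := h
  obtain ⟨η, hη⟩ := h'
  exact ⟨.and θ η, fun e => and_congr (hθ e) (hη e)⟩

theorem or (h : Definable P) (h' : Definable Q) : Definable fun e => P e ∨ Q e := by
  obtain ⟨θ, hθ⟩ := h
  obtain ⟨η, hη⟩ := h'
  exact ⟨.or θ η, fun e => or_congr (hθ e) (hη e)⟩

theorem imp (h : Definable P) (h' : Definable Q) : Definable fun e => P e → Q e := by
  obtain ⟨θ, hθ⟩ := h
  obtain ⟨η, hη⟩ := h'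
  exact ⟨.imp θ η, fun e => imp_congr (hθ e) (hη e)⟩

theorem ex (x : ℕ) (h : Definable P) : Definable fun e => ∃ n, P (Function.update e x n) := by
  obtain ⟨θ, hθ⟩ := h
  exact ⟨.ex x θ, fun e => exists_congr fun n => hθ _⟩

theorem all (x : ℕ) (h : Definable P) : Definable fun e => ∀ n, P (Function.update e x n) := by
  obtain ⟨θ, hθ⟩ := h
  exact ⟨.all x θ, fun e => forall_congr' fun n => hθ _⟩

theorem var_eq (i j : ℕ) : Definable fun e => e i = e j := eq (.var i) (.var j)

/-- Quantified copies replace substitution. The intermediate variables `i + j + 2` and `i + j + 3`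
differ from `0`, `1`, `i` and `j`, which prevents capture. -/
theorem rename {R : ℕ → ℕ → Prop} (h : Definable fun e => R (e 0) (e 1)) (i j : ℕ) :
    Definable fun e => R (e i) (e j) := by
  refine ((((((h.and (var_eq 1 (i + j + 3))).ex 1).and (var_eq 0 (i + j + 2))).ex 0).and
    ((var_eq (i + j + 2) i).and (var_eq (i + j + 3) j))).ex (i + j + 3)).ex (i + j + 2)
    |>.of_iff fun e => ?_
  have h2 : i ≠ i + j + 3 := by omega
  have h3 : i ≠ i + j + 2 := by omega
  have h4 : j ≠ i + j + 3 := by omega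
  have h5 : j ≠ i + j + 2 := by omega
  simp [h2, h3, h4, h5]

theorem pair_eq (k i j : ℕ) : Definable fun e => e k = Nat.pair (e i) (e j) := by
  refine (((lt (.var i) (.var j)).and (eq (.var k) (.add (.mul (.var j) (.var j)) (.var i)))).or
    ((lt (.var i) (.var j)).not.and
      (eq (.var k) (.add (.add (.mul (.var i) (.var i)) (.var i)) (.var j))))).of_iff fun e => ?_
  simp only [Term.eval, Nat.pair]
  split_ifs with h <;> simp [h]

theorem beta_eq : Definable fun e => e 2 = Nat.beta (e 0) (e 1) := by
  let t : Term := .add (.mul (.add (.var 1) .one) (.var 4)) .one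
  -- Variables 3 and 4 are the components of the code, and 5 is the quotient of the division whose
  -- remainder is the value.
  refine ((((pair_eq 0 3 4).and ((eq (.var 3) (.add (.mul (.var 5) t) (.var 2))).and
    (lt (.var 2) t))).ex 3).ex 4).ex 5 |>.of_iff fun e => ?_
  simp only [Term.eval, t, Function.update_apply, Nat.beta]
  norm_num
  constructor
  · rintro ⟨q, y, x, h0, h1, h2⟩
    rw [h0, Nat.unpair_pair, h1, Nat.add_comm, Nat.add_mul_mod_self_right, Nat.mod_eq_of_lt (Nat.lt_succ_of_le h2)]
  · intro h
    refine ⟨(e 0).unpair.1 / ((e 1 + 1) * (e 0).unpair.2 + 1), (e 0).unpair.2, (e 0).unpair.1,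
      (Nat.pair_unpair _).symm, ?_, ?_⟩
    · rw [h, Nat.mul_comm, Nat.div_add_mod]
    · rw [h]
      exact Nat.le_of_lt_succ (Nat.mod_lt _ (Nat.succ_pos _))

theorem rename₃ {R : ℕ → ℕ → ℕ → Prop} (h : Definable fun e => R (e 0) (e 1) (e 2)) (i j k : ℕ) :
    Definable fun e => R (e i) (e j) (e k) := by
  let s := i + j + k + 3
  refine ((((((((h.and (var_eq 2 (s + 2))).ex 2).and (var_eq 1 (s + 1))).ex 1).and
    (var_eq 0 s)).ex 0).and
    ((var_eq s i).and ((var_eq (s + 1) j).and (var_eq (s + 2) k)))).ex (s + 2)).ex (s + 1)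
    |>.ex s |>.of_iff fun e => ?_
  have h1 : i ≠ s := by omega
  have h2 : j ≠ s := by omega
  have h3 : k ≠ s := by omega
  have h4 : i ≠ s + 1 := by omega
  have h5 : j ≠ s + 1 := by omega
  have h6 : k ≠ s + 1 := by omega
  have h7 : i ≠ s + 2 := by omega
  have h8 : j ≠ s + 2 := by omega
  have h9 : k ≠ s + 2 := by omega
  have h10 : s ≠ 0 := by omega
  simp [h1, h2, h3, h4, h5, h6, h7, h8, h9, h10]

end Definable

theorem exists_beta_eq (f : ℕ → ℕ) (m : ℕ) : ∃ c, ∀ i ≤ m, Nat.beta c i = f i := by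
  refine ⟨Nat.unbeta ((List.range (m + 1)).map f), fun i hi => ?_⟩
  have := Nat.beta_unbeta_coe ((List.range (m + 1)).map f) ⟨i, by simp; omega⟩
  simpa using this

/-- Gödel's beta function codes the course of values by one number, so that primitive recursion
becomes a first-order condition. -/
theorem mem_prec_iff {f g : ℕ → Part ℕ} (a k : ℕ) : ∀ m : ℕ,
    k ∈ (Nat.rec (f a) (fun y IH => IH.bind fun i => g (Nat.pair a (Nat.pair y i))) m : Part ℕ) ↔
    ∃ c, Nat.beta c 0 ∈ f a ∧ (∀ i < m, Nat.beta c (i + 1) ∈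
      g (Nat.pair a (Nat.pair i (Nat.beta c i)))) ∧ Nat.beta c m = k := by
  -- The induction is done for arbitrary sequences, since these, unlike codes, are easily extended
  -- by one value.
  suffices H : ∀ m k, k ∈ (Nat.rec (f a)
      (fun y IH => IH.bind fun i => g (Nat.pair a (Nat.pair y i))) m : Part ℕ) ↔
      ∃ s : ℕ → ℕ, s 0 ∈ f a ∧ (∀ i < m, s (i + 1) ∈
      g (Nat.pair a (Nat.pair i (s i)))) ∧ s m = k by
    intro m
    rw [H]
    constructor
    · rintro ⟨s, h0, h1, h2⟩
      obtain ⟨c, hc⟩ := exists_beta_eq s m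
      refine ⟨c, by rwa [hc 0 (Nat.zero_le _)], fun i hi => ?_, by rw [hc m le_rfl, h2]⟩
      rw [hc _ hi, hc _ hi.le]
      exact h1 i hi
    · rintro ⟨c, h⟩
      exact ⟨Nat.beta c, h⟩
  intro m
  induction m with
  | zero =>
    intro k
    constructor
    · intro h
      exact ⟨fun _ => k, h, fun i hi => absurd hi (Nat.not_lt_zero _), rfl⟩
    · rintro ⟨s, h, _, rfl⟩
      exact h
  | succ m ih =>
    intro k
    simp only [Part.mem_bind_iff, ih]
    constructor
    · rintro ⟨i, ⟨s, h0, h1, rfl⟩, hk⟩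
      refine ⟨Function.update s (m + 1) k, by simpa using h0, fun i hi => ?_, by simp⟩
      rcases Nat.lt_succ_iff_lt_or_eq.1 hi with h | rfl
      · rw [Function.update_of_ne (by omega), Function.update_of_ne (by omega)]
        exact h1 i h
      · rw [Function.update_self, Function.update_of_ne (by omega)]
        exact hk
    · rintro ⟨s, h0, h1, rfl⟩
      exact ⟨s m, ⟨s, h0, fun i hi => h1 i (by omega), rfl⟩, h1 m (Nat.lt_succ_self _)⟩

theorem mem_rfind_iff {f : ℕ → Part ℕ} (a k : ℕ) :
    k ∈ Nat.rfind (fun n => (f (Nat.pair a n)).map fun m => decide (m = 0)) ↔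
      0 ∈ f (Nat.pair a k) ∧ ∀ i < k, ∃ v, v + 1 ∈ f (Nat.pair a i) := by
  refine Nat.mem_rfind.trans ?_
  simp only [Part.mem_map_iff, decide_eq_true_eq, decide_eq_false_iff_not]
  constructor
  · rintro ⟨⟨v, hv, rfl⟩, h⟩
    refine ⟨hv, fun i hi => ?_⟩
    obtain ⟨w, hw, hw0⟩ := h hi
    exact ⟨w - 1, by rwa [Nat.sub_add_cancel (Nat.pos_of_ne_zero hw0)]⟩
  · rintro ⟨h, h'⟩
    refine ⟨⟨0, h, rfl⟩, fun {i} hi => ?_⟩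
    obtain ⟨v, hv⟩ := h' i hi
    exact ⟨v + 1, hv, Nat.succ_ne_zero _⟩

/-- Graphs of partial recursive functions are arithmetical. -/
theorem Definable.of_partrec {f : ℕ →. ℕ} (hf : Nat.Partrec f) :
    Definable fun e => e 1 ∈ f (e 0) := by
  induction hf with
  | zero =>
    exact (Definable.eq (.var 1) .zero).of_iff fun e => by simp [Term.eval, pure, PFun.pure]
  | succ =>
    exact (Definable.eq (.var 1) (.add (.var 0) .one)).of_iff fun e => by simp [Term.eval]
  | left =>
    refine ((Definable.pair_eq 0 1 2).ex 2).of_iff fun e => ?_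
    simp only [Function.update_apply, PFun.coe_val, Part.mem_some_iff]
    norm_num
    constructor
    · rintro ⟨n, h⟩
      simp [h]
    · intro h
      exact ⟨(e 0).unpair.2, by rw [h, Nat.pair_unpair]⟩
  | right =>
    refine ((Definable.pair_eq 0 2 1).ex 2).of_iff fun e => ?_
    simp only [Function.update_apply, PFun.coe_val, Part.mem_some_iff]
    norm_num
    constructor
    · rintro ⟨n, h⟩
      simp [h]
    · intro h
      exact ⟨(e 0).unpair.1, by rw [h, Nat.pair_unpair]⟩
  | @pair f g _ _ hf hg =>
    refine ((((hf.rename (R := fun n k => k ∈ f n) 0 2).and ((hg.rename (R := fun n k => k ∈ g n)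
      0 3).and (Definable.pair_eq 1 2 3))).ex 2).ex 3).of_iff fun e => ?_
    simp only [Function.update_apply, Seq.seq, Part.map_eq_map, Part.mem_bind_iff, Part.mem_map_iff]
    norm_num
    constructor
    · rintro ⟨v, u, hu, hv, h⟩
      exact ⟨u, hu, v, hv, h.symm⟩
    · rintro ⟨u, hu, v, hv, h⟩
      exact ⟨v, u, hu, hv, h.symm⟩
  | @comp f g _ _ hf hg =>
    refine (((hg.rename (R := fun n k => k ∈ g n) 0 2).and
      (hf.rename (R := fun n k => k ∈ f n) 2 1)).ex 2).of_iff fun e => ?_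
    refine Iff.trans ?_ (Part.mem_bind_iff (f := g (e 0)) (g := f)).symm
    simp
  | @prec f g _ _ hf hg =>
    have hb (i j k : ℕ) : Definable fun e => e k = Nat.beta (e i) (e j) :=
      Definable.beta_eq.rename₃ (R := fun x y z => z = Nat.beta x y) i j k
    -- variables: 2 = a, 3 = m, 4 = c, 5 = zero or the step, 6 = its successor, 7, 8 = values
    have h0 := (((Definable.eq (.var 5) .zero).and ((hb 4 5 7).and
      (hf.rename (R := fun n k => k ∈ f n) 2 7))).ex 5).ex 7
    have hs := (Definable.eq (.var 6) (.add (.var 5) .one)).and ((hb 4 5 7).and ((hb 4 6 8).and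
        ((Definable.pair_eq 9 5 7).and ((Definable.pair_eq 10 2 9).and
          (hg.rename (R := fun n k => k ∈ g n) 10 8)))))
    have h1 := ((Definable.lt (.var 5) (.var 3)).imp
      (((((hs.ex 6).ex 7).ex 8).ex 9).ex 10)).all 5
    refine (((Definable.pair_eq 0 2 3).and ((h0.and (h1.and (hb 4 3 1))).ex 4)).ex 2).ex 3
      |>.of_iff fun e => ?_
    refine Iff.trans ?_ (mem_prec_iff (f := f) (g := g) _ _ _).symm
    simp only [Function.update_apply, Term.eval]
    norm_num
    constructor
    · rintro ⟨m, a, h, c, h0, h1, h2⟩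
      rw [h, Nat.unpair_pair]
      exact ⟨c, h0, h1, h2.symm⟩
    · rintro ⟨c, h0, h1, h2⟩
      exact ⟨_, _, (Nat.pair_unpair _).symm, c, h0, h1, h2.symm⟩
  | @rfind f _ hf =>
    have h0 := (((Definable.pair_eq 2 0 1).and ((Definable.eq (.var 3) .zero).and
      (hf.rename (R := fun n k => k ∈ f n) 2 3))).ex 3).ex 2
    have h1 := ((Definable.lt (.var 4) (.var 1)).imp
      ((((Definable.pair_eq 2 0 4).and ((Definable.lt .zero (.var 3)).and
        (hf.rename (R := fun n k => k ∈ f n) 2 3))).ex 3).ex 2)).all 4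
    refine (h0.and h1).of_iff fun e => ?_
    refine Iff.trans ?_ (mem_rfind_iff (f := f) _ _).symm
    simp only [Function.update_apply, Term.eval]
    norm_num
    refine fun _ => forall_congr' fun i => imp_congr_right fun _ => ?_
    constructor
    · rintro ⟨v, h, hv⟩
      exact ⟨v - 1, by rwa [Nat.sub_add_cancel h]⟩
    · rintro ⟨v, hv⟩
      exact ⟨v + 1, Nat.succ_pos _, hv⟩

end ConstructiveTruth

namespace ConstructiveTruth

open Encodable

/-! ### Arithmetical predicates on encoded types. -/

/-- A property of elements of a primitively encoded type is arithmetical if it is definable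
from the codes of these elements. -/
def Arith {σ : Type*} [Primcodable σ] (P : σ → Prop) : Prop :=
  Definable fun e => ∃ s, encode s = e 0 ∧ P s

theorem Definable.of_primrecPred {P : ℕ → Prop} (h : PrimrecPred P) :
    Definable fun e => P (e 0) := by
  obtain ⟨_, h⟩ := h
  have hf : Nat.Partrec (fun n => Part.some (if decide (P n) then 1 else 0) : ℕ →. ℕ) :=
    Partrec.nat_iff.1 (Primrec.cond h (Primrec.const 1) (Primrec.const 0) |>.to_comp |>.partrec
      |>.of_eq fun n => by by_cases hn : P n <;> simp [hn])
  refine (((Definable.of_partrec hf).and (Definable.eq (.var 1) .one)).ex 1).of_iff fun e => ?_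
  by_cases hn : P (e 0) <;> simp [hn, Term.eval]

namespace Arith

variable {σ τ : Type*} [Primcodable σ] [Primcodable τ] {P Q : σ → Prop}

theorem mem_range : Definable fun e => e 0 ∈ Set.range (encode : σ → ℕ) :=
  Definable.of_primrecPred (Primcodable.mem_range_encode (α := σ))

theorem of_iff (h : Arith P) (H : ∀ s, P s ↔ Q s) : Arith Q :=
  Definable.of_iff h fun _ => exists_congr fun s => and_congr_right fun _ => H s

theorem not (h : Arith P) : Arith fun s => ¬ P s := by
  -- Numbers that code nothing satisfy the plain negation, so the range of `encode` has to be added.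
  refine ((mem_range (σ := σ)).and (Definable.not h)).of_iff fun e => ?_
  constructor
  · rintro ⟨⟨s, hs⟩, h⟩
    exact ⟨s, hs, fun h' => h ⟨s, hs, h'⟩⟩
  · rintro ⟨s, hs, h⟩
    refine ⟨⟨s, hs⟩, ?_⟩
    rintro ⟨s', hs', h'⟩
    rw [encode_injective (hs'.trans hs.symm)] at h'
    exact h h'

theorem and (h : Arith P) (h' : Arith Q) : Arith fun s => P s ∧ Q s := by
  refine (Definable.and h h').of_iff fun e => ?_
  constructor
  · rintro ⟨⟨s, hs, h⟩, s', hs', h'⟩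
    rw [encode_injective (hs'.trans hs.symm)] at h'
    exact ⟨s, hs, h, h'⟩
  · rintro ⟨s, hs, h, h'⟩
    exact ⟨⟨s, hs, h⟩, s, hs, h'⟩

theorem or (h : Arith P) (h' : Arith Q) : Arith fun s => P s ∨ Q s :=
  (h.not.and h'.not).not.of_iff fun s => by tauto

theorem imp (h : Arith P) (h' : Arith Q) : Arith fun s => P s → Q s :=
  (h.and h'.not).not.of_iff fun s => by tauto

theorem ex {P : σ → τ → Prop} (h : Arith fun x : σ × τ => P x.1 x.2) :
    Arith fun s => ∃ t, P s t := by
  have h' : Definable fun e => ∃ x : σ × τ, encode x = e 2 ∧ P x.1 x.2 :=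
    h.rename (R := fun n _ => ∃ x : σ × τ, encode x = n ∧ P x.1 x.2) 2 2
  refine (((h'.and (Definable.pair_eq 2 0 1)).ex 2).ex 1).of_iff fun e => ?_
  simp only [Prod.exists, Function.update_apply, encode_prod_val]
  norm_num
  constructor
  · rintro ⟨n, s, t, h, ht⟩
    exact ⟨s, h.1, t, ht⟩
  · rintro ⟨s, hs, t, ht⟩
    exact ⟨encode t, s, t, ⟨hs, rfl⟩, ht⟩

theorem all {P : σ → τ → Prop} (h : Arith fun x : σ × τ => P x.1 x.2) :
    Arith fun s => ∀ t, P s t :=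
  (Arith.ex (P := fun s t => ¬ P s t) h.not).not.of_iff fun s => by simp

theorem of_partrec {f : σ →. τ} (hf : Partrec f) : Arith fun x : σ × τ => x.2 ∈ f x.1 := by
  refine ((mem_range (σ := σ × τ)).and ((((Definable.pair_eq 0 2 1).and
    ((Definable.of_partrec hf).rename (R := fun n k => k ∈ Part.bind (decode (α := σ) n)
      fun a => (f a).map encode) 2 1)).ex 2).ex 1)).of_iff fun e => ?_
  simp only [Function.update_apply]
  norm_num
  constructor
  · rintro ⟨⟨s, t, hst⟩, u, v, huv, a, ha, b, hb, rfl⟩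
    rw [← hst, Nat.pair_eq_pair] at huv
    rw [← huv.1] at ha
    rw [encodek, Option.some.injEq] at ha
    have hbt := encode_injective huv.2
    subst ha hbt
    exact ⟨s, t, hst, hb⟩
  · rintro ⟨s, t, hst, h⟩
    exact ⟨⟨s, t, hst⟩, _, _, hst.symm, s, encodek s, t, h, rfl⟩

theorem comp {P : τ → Prop} (h : Arith P) {f : σ → τ} (hf : Computable f) :
    Arith fun s => P (f s) := by
  have h2 : Arith fun x : σ × τ => P x.2 := by
    have h' : Definable fun e => ∃ x : τ, encode x = e 1 ∧ P x :=
      h.rename (R := fun n _ => ∃ x : τ, encode x = n ∧ P x) 1 1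
    refine ((mem_range (σ := σ × τ)).and (((h'.and (Definable.pair_eq 0 2 1)).ex 2).ex 1)).of_iff
      fun e => ?_
    simp only [Function.update_apply]
    norm_num
    constructor
    · rintro ⟨⟨s, t, hst⟩, u, ⟨t', rfl, ht⟩, v, huv⟩
      rw [← hst, Nat.pair_eq_pair] at huv
      rw [← encode_injective huv.2] at ht
      exact ⟨s, t, hst, ht⟩
    · rintro ⟨s, t, hst, ht⟩
      exact ⟨⟨s, t, hst⟩, _, ⟨t, rfl, ht⟩, _, hst.symm⟩
  exact (Arith.ex (P := fun s t => t ∈ (f : σ →. τ) s ∧ P t)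
    ((of_partrec hf.partrec).and h2)).of_iff fun s => by simp

theorem of_primrecPred (h : PrimrecPred P) : Arith P := by
  obtain ⟨_, h⟩ := h
  have hb : Arith fun b : Bool => b = true := by
    have h1 : Arith fun x : ℕ × ℕ => x.2 = x.1 :=
      (of_partrec (Computable.id (α := ℕ)).partrec).of_iff fun x => by simp
    have h2 : Arith fun b : Bool => encode b = encode true :=
      h1.comp (f := fun b : Bool => (encode true, encode b))
        ((Computable.const _).pair Computable.encode)
    exact h2.of_iff fun b => encode_inj
  exact (hb.comp h.to_comp).of_iff fun s => by simp

end Arith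

/-- Variables on which `P` does not depend can be bound by vacuous existential quantifiers. -/
theorem Definable.exists_freeVars_subset {P : (ℕ → ℕ) → Prop} (h : Definable P) (s : Finset ℕ)
    (hs : ∀ e x n, x ∉ s → (P (Function.update e x n) ↔ P e)) :
    ∃ θ : ArithFormula, θ.freeVars ⊆ s ∧ ∀ e, θ.Holds (fun X => X.elim) e ↔ P e := by
  obtain ⟨θ, hθ⟩ := h
  suffices H : ∀ t : Finset ℕ, (∀ x ∈ t, x ∉ s) → ∃ η : ArithFormula,
      η.freeVars ⊆ θ.freeVars \ t ∧ ∀ e, η.Holds (fun X => X.elim) e ↔ P e by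
    obtain ⟨η, h1, h2⟩ := H (θ.freeVars \ s) (by simp)
    exact ⟨η, h1.trans (by intro x; simp), h2⟩
  intro t
  induction t using Finset.induction_on with
  | empty => exact fun _ => ⟨θ, by simp, hθ⟩
  | insert x t _ ih =>
    intro ht
    obtain ⟨η, h1, h2⟩ := ih fun y hy => ht y (Finset.mem_insert_of_mem hy)
    refine ⟨.ex x η, ?_, fun e => ?_⟩
    · intro y hy
      simp only [Formula.freeVars, Finset.mem_erase] at hy
      have := h1 hy.2
      simp only [Finset.mem_sdiff, Finset.mem_insert] at this ⊢
      tauto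
    · simp only [Formula.Holds, h2, hs _ _ _ (ht x (Finset.mem_insert_self _ _)), exists_const]

/-! ### Witnesses and classical truth -/

theorem applies_of_const (γ β : ℕ → ℕ) : Applies (fun z => γ z.unpair.1 + 1) β γ := by
  intro n
  exact ⟨0, by simp, by simp⟩

/-- With arbitrary functions as witnesses, realizability collapses to classical truth: a true
implication is witnessed by a constant functional or, if its antecedent is false, by anything. -/
theorem exists_witnesses_iff (φ : ArithFormula) : ∀ e : ℕ → ℕ,
    (∃ α, Witnesses φ e α) ↔ φ.Holds (fun X => X.elim) e := by
  induction φ with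
  | eq s t => intro e; simp [Witnesses, Formula.Holds]
  | lt s t => intro e; simp [Witnesses, Formula.Holds]
  | mem t X => exact X.elim
  | neg A ih =>
    intro e
    simp only [Witnesses, Formula.Holds, ← ih]
    simp
  | and A B ihA ihB =>
    intro e
    simp only [Witnesses, Formula.Holds, ← ihA, ← ihB]
    constructor
    · rintro ⟨α, h⟩
      exact ⟨⟨_, h.1⟩, _, h.2⟩
    · rintro ⟨⟨α, hα⟩, β, hβ⟩
      refine ⟨fun k => if k % 2 = 0 then α (k / 2) else β (k / 2), ?_, ?_⟩
      · simpa using hα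
      · simpa [Nat.add_mod, Nat.mul_add_div] using hβ
  | or A B ihA ihB =>
    intro e
    simp only [Witnesses, Formula.Holds, ← ihA, ← ihB]
    constructor
    · rintro ⟨α, h | h⟩
      · exact Or.inl ⟨_, h.2⟩
      · exact Or.inr ⟨_, h.2⟩
    · rintro (⟨α, hα⟩ | ⟨α, hα⟩)
      · exact ⟨fun k => k.casesOn 0 α, Or.inl ⟨rfl, hα⟩⟩
      · exact ⟨fun k => k.casesOn 1 α, Or.inr ⟨one_ne_zero, hα⟩⟩
  | imp A B ihA ihB =>
    intro e
    simp only [Witnesses, Formula.Holds, ← ihA, ← ihB]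
    constructor
    · rintro ⟨α, h⟩ ⟨β, hβ⟩
      obtain ⟨γ, _, hγ⟩ := h β hβ
      exact ⟨γ, hγ⟩
    · intro h
      by_cases hB : ∃ γ, Witnesses B e γ
      · obtain ⟨γ, hγ⟩ := hB
        exact ⟨_, fun β _ => ⟨γ, applies_of_const γ β, hγ⟩⟩
      · exact ⟨fun _ => 0, fun β hβ => absurd (h ⟨β, hβ⟩) hB⟩
  | ex x A ih =>
    intro e
    simp only [Witnesses, Formula.Holds, ← ih]
    constructor
    · rintro ⟨α, h⟩
      exact ⟨_, _, h⟩
    · rintro ⟨n, α, h⟩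
      exact ⟨fun k => k.casesOn n α, h⟩
  | all x A ih =>
    intro e
    simp only [Witnesses, Formula.Holds, ← ih]
    constructor
    · rintro ⟨α, h⟩ n
      exact ⟨_, h n⟩
    · intro h
      choose α hα using h
      exact ⟨fun k => α k.unpair.1 k.unpair.2, by simpa using hα⟩

/-- A doubly negated formula is witnessed by every function or by none, so it can state an
arithmetical fact without revealing anything. -/
theorem witnesses_neg_neg_iff (φ : ArithFormula) (e α : ℕ → ℕ) :
    Witnesses (.neg (.neg φ)) e α ↔ φ.Holds (fun X => X.elim) e := by
  rw [← exists_witnesses_iff]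
  simp [Witnesses]

/-! ### Numerals and parametrized families of formulas without content. -/

/-- The numeral of a number. -/
def numeral : ℕ → Term
  | 0 => .zero
  | n + 1 => .add (numeral n) .one

@[simp] theorem eval_numeral (e : ℕ → ℕ) (n : ℕ) : (numeral n).eval e = n := by
  induction n with
  | zero => rfl
  | succ n ih => simp [numeral, Term.eval, ih]

@[simp] theorem freeVars_numeral (n : ℕ) : (numeral n).freeVars = ∅ := by
  induction n with
  | zero => rfl
  | succ n ih => simp [numeral, Term.freeVars, ih]

theorem primrec_code_numeral : Primrec fun n => (numeral n).code := by
  have h : Primrec fun n : ℕ => (Nat.rec (Nat.pair 1 0)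
      (fun _ c => Nat.pair 3 (Nat.pair c (Nat.pair 2 0))) n : ℕ) :=
    Primrec.nat_rec₁ _ (Primrec₂.natPair.comp (Primrec.const 3)
      (Primrec₂.natPair.comp Primrec.snd (Primrec.const _))).to₂
  refine h.of_eq fun n => ?_
  induction n with
  | zero => rfl
  | succ n ih => simp only [numeral, Term.code]; rw [← ih]

/-- A family of formulas without constructive content, expressing an arithmetical relation
between a parameter and the variables `v₁`, `v₂`, `v₃`. -/
theorem Arith.exists_family {P : ℕ × ℕ × ℕ × ℕ → Prop} (h : Arith P) (s : Finset ℕ)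
    (hs : ∀ a (e : ℕ → ℕ) x n, x ∉ s → (P (a, Function.update e x n 1, Function.update e x n 2,
      Function.update e x n 3) ↔ P (a, e 1, e 2, e 3))) :
    ∃ F : ℕ → ArithFormula, (∀ a, (F a).freeVars ⊆ s) ∧ (Computable fun a => (F a).code) ∧
      ∀ a e α, Witnesses (F a) e α ↔ P (a, e 1, e 2, e 3) := by
  have h' : Definable fun e => P (e 0, e 1, e 2, e 3) := by
    refine (((((Definable.pair_eq 5 2 3).and ((Definable.pair_eq 6 1 5).and
      ((Definable.pair_eq 7 0 6).and (h.rename (R := fun n _ => ∃ s, encode s = n ∧ P s)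
        7 7)))).ex 5).ex 6).ex 7).of_iff fun e => ?_
    simp only [Function.update_apply]
    norm_num
    constructor
    · rintro ⟨_, _, _, _, ⟨rfl, rfl, rfl, rfl⟩, h⟩
      exact h
    · exact fun h => ⟨_, _, _, _, ⟨rfl, rfl, rfl, rfl⟩, h⟩
  have hu (e : ℕ → ℕ) (x n : ℕ) (hx : x ∉ insert 0 s) :
      P (Function.update e x n 0, Function.update e x n 1, Function.update e x n 2,
        Function.update e x n 3) ↔ P (e 0, e 1, e 2, e 3) := by
    simp only [Finset.mem_insert, not_or] at hx
    rw [hs _ _ _ _ hx.2, Function.update_of_ne (Ne.symm hx.1)]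
  obtain ⟨θ, h1, h2⟩ := h'.exists_freeVars_subset (insert 0 s) hu
  have hP (e : ℕ → ℕ) (a : ℕ) : P (a, Function.update e 0 a 1, Function.update e 0 a 2,
      Function.update e 0 a 3) ↔ P (a, e 1, e 2, e 3) := by
    simp
  -- The parameter enters only through the numeral assigned to `v₀`; as `θ` is fixed, the Gödel
  -- number is primitive recursive in `a`.
  refine ⟨fun a => .neg (.neg (.ex 0 (.and (.eq (.var 0) (numeral a)) θ))), fun a x => ?_, ?_,
    fun a e α => ?_⟩
  · have := @h1 x
    simp only [Formula.freeVars, Term.freeVars, freeVars_numeral, Finset.mem_erase,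
      Finset.mem_union, Finset.mem_singleton, Finset.mem_insert] at this ⊢
    simp
    tauto
  · refine Primrec.to_comp ?_
    have hp {f : ℕ → ℕ} (hf : Primrec f) (n : ℕ) : Primrec fun a => Nat.pair n (f a) :=
      Primrec₂.natPair.comp (Primrec.const n) hf
    exact hp (hp (hp (hp (hp (Primrec₂.natPair.comp (hp (hp primrec_code_numeral _) _)
      (Primrec.const _)) _) _) _) _) _
  · rw [witnesses_neg_neg_iff]
    simp [Formula.Holds, h2, Term.eval]

end ConstructiveTruth

namespace ConstructiveTruth

theorem PrimrecPred.iff' {α : Type*} [Primcodable α] {p q : α → Prop} (hp : PrimrecPred p)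
    (hq : PrimrecPred q) : PrimrecPred fun a => p a ↔ q a :=
  ((hp.and hq).or (hp.not.and hq.not)).of_eq fun a => by tauto

theorem PrimrecPred.imp' {α : Type*} [Primcodable α] {p q : α → Prop} (hp : PrimrecPred p)
    (hq : PrimrecPred q) : PrimrecPred fun a => p a → q a :=
  (hp.not.or hq).of_eq fun a => by tauto

/-! ### Numbers as assignments -/

/-- The assignment coded by a number, read as an infinite sequence by iterated unpairing. -/
def assign (c : ℕ) : ℕ → ℕ
  | 0 => c.unpair.1
  | x + 1 => assign c.unpair.2 x

/-- Change the value of the variable `v_x` to `n` in a coded assignment. -/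
def assignUpdate : ℕ → ℕ → ℕ → ℕ
  | 0, n, c => Nat.pair n c.unpair.2
  | x + 1, n, c => Nat.pair c.unpair.1 (assignUpdate x n c.unpair.2)

theorem assign_assignUpdate (x n c : ℕ) :
    assign (assignUpdate x n c) = Function.update (assign c) x n := by
  induction x generalizing c with
  | zero => funext y; cases y <;> simp [assign, assignUpdate]
  | succ x ih => funext y; cases y <;> simp [assign, assignUpdate, ih, Function.update_apply]

theorem primrec_assign (x : ℕ) : Primrec fun c => assign c x := by
  induction x with
  | zero => exact Primrec.fst.comp Primrec.unpair
  | succ x ih => exact ih.comp (Primrec.snd.comp Primrec.unpair)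

theorem primrec_assignUpdate (x : ℕ) : Primrec fun m : ℕ × ℕ => assignUpdate x m.1 m.2 := by
  induction x with
  | zero => exact Primrec₂.natPair.comp Primrec.fst (Primrec.snd.comp (Primrec.unpair.comp Primrec.snd))
  | succ x ih =>
    exact Primrec₂.natPair.comp (Primrec.fst.comp (Primrec.unpair.comp Primrec.snd))
      (ih.comp (Primrec.fst.pair (Primrec.snd.comp (Primrec.unpair.comp Primrec.snd))))

theorem primrec_eval_assign (t : Term) : Primrec fun c => t.eval (assign c) := by
  induction t with
  | var x => exact primrec_assign x
  | zero => exact Primrec.const 0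
  | one => exact Primrec.const 1
  | add s t ihs iht => exact Primrec.nat_add.comp ihs iht
  | mul s t ihs iht => exact Primrec.nat_mul.comp ihs iht

theorem Term.eval_congr {e e' : ℕ → ℕ} (t : Term) (h : ∀ x ∈ t.freeVars, e x = e' x) :
    t.eval e = t.eval e' := by
  induction t with
  | var x => exact h x (by simp [Term.freeVars])
  | zero => rfl
  | one => rfl
  | add s t ihs iht | mul s t ihs iht =>
    simp only [Term.freeVars, Finset.mem_union] at h
    simp only [Term.eval, ihs fun x hx => h x (Or.inl hx), iht fun x hx => h x (Or.inr hx)]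

theorem Formula.holds_congr {σ : Type} {I : σ → Set ℕ} (φ : Formula σ) : ∀ {e e' : ℕ → ℕ},
    (∀ x ∈ φ.freeVars, e x = e' x) → (φ.Holds I e ↔ φ.Holds I e') := by
  induction φ with
  | eq s t | lt s t =>
    intro e e' h
    simp only [Formula.freeVars, Finset.mem_union] at h
    simp only [Formula.Holds, s.eval_congr fun x hx => h x (Or.inl hx),
      t.eval_congr fun x hx => h x (Or.inr hx)]
  | mem t X =>
    intro e e' h
    simp only [Formula.Holds, t.eval_congr h]
  | neg A ih => exact fun h => not_congr (ih h)
  | and A B ihA ihB | or A B ihA ihB | imp A B ihA ihB =>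
    intro e e' h
    simp only [Formula.freeVars, Finset.mem_union] at h
    simp only [Formula.Holds, ihA fun x hx => h x (Or.inl hx), ihB fun x hx => h x (Or.inr hx)]
  | ex y A ih =>
    intro e e' h
    refine exists_congr fun n => ih fun x hx => ?_
    by_cases hxy : x = y
    · simp [hxy]
    · simpa [hxy] using h x (by simp [Formula.freeVars, hxy, hx])
  | all y A ih =>
    intro e e' h
    refine forall_congr' fun n => ih fun x hx => ?_
    by_cases hxy : x = y
    · simp [hxy]
    · simpa [hxy] using h x (by simp [Formula.freeVars, hxy, hx])

/-! ### Truth tables with Skolem functions -/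

/-- `G` is a truth table with Skolem functions for a formula and its subformulas:
`G ⟨0, c⟩` is the truth value under the assignment coded by `c`, the slices `G ⟨1, ·⟩` and
`G ⟨2, ·⟩` are tables for the immediate subformulas, and `G ⟨3, c⟩` is the critical instance of a
quantifier. The set variables are interpreted by the supports of `u` and `v`. -/
def TruthTable (u v : ℕ → ℕ) : Formula (Fin 2) → (ℕ → ℕ) → Prop
  | .eq s t, G => ∀ c, G (Nat.pair 0 c) ≠ 0 ↔ s.eval (assign c) = t.eval (assign c)
  | .lt s t, G => ∀ c, G (Nat.pair 0 c) ≠ 0 ↔ s.eval (assign c) < t.eval (assign c)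
  | .mem t X, G => ∀ c, G (Nat.pair 0 c) ≠ 0 ↔ (if X = 0 then u else v) (t.eval (assign c)) ≠ 0
  | .neg A, G => TruthTable u v A (fun k => G (Nat.pair 1 k)) ∧
      ∀ c, G (Nat.pair 0 c) ≠ 0 ↔ ¬ G (Nat.pair 1 (Nat.pair 0 c)) ≠ 0
  | .and A B, G => (TruthTable u v A (fun k => G (Nat.pair 1 k)) ∧
      TruthTable u v B (fun k => G (Nat.pair 2 k))) ∧
      ∀ c, G (Nat.pair 0 c) ≠ 0 ↔
        (G (Nat.pair 1 (Nat.pair 0 c)) ≠ 0 ∧ G (Nat.pair 2 (Nat.pair 0 c)) ≠ 0)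
  | .or A B, G => (TruthTable u v A (fun k => G (Nat.pair 1 k)) ∧
      TruthTable u v B (fun k => G (Nat.pair 2 k))) ∧
      ∀ c, G (Nat.pair 0 c) ≠ 0 ↔
        (G (Nat.pair 1 (Nat.pair 0 c)) ≠ 0 ∨ G (Nat.pair 2 (Nat.pair 0 c)) ≠ 0)
  | .imp A B, G => (TruthTable u v A (fun k => G (Nat.pair 1 k)) ∧
      TruthTable u v B (fun k => G (Nat.pair 2 k))) ∧
      ∀ c, G (Nat.pair 0 c) ≠ 0 ↔
        (G (Nat.pair 1 (Nat.pair 0 c)) ≠ 0 → G (Nat.pair 2 (Nat.pair 0 c)) ≠ 0)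
  -- The inspected places must not depend on values of `G`. So the instance `m.unpair.1` runs over
  -- all numbers, and the Skolem clause takes effect only where it equals `G ⟨3, c⟩`.
  | .ex x A, G => TruthTable u v A (fun k => G (Nat.pair 1 k)) ∧
      ∀ m : ℕ, (G (Nat.pair 0 m.unpair.2) ≠ 0 → G (Nat.pair 3 m.unpair.2) = m.unpair.1 →
        G (Nat.pair 1 (Nat.pair 0 (assignUpdate x m.unpair.1 m.unpair.2))) ≠ 0) ∧
        (G (Nat.pair 1 (Nat.pair 0 (assignUpdate x m.unpair.1 m.unpair.2))) ≠ 0 →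
          G (Nat.pair 0 m.unpair.2) ≠ 0)
  | .all x A, G => TruthTable u v A (fun k => G (Nat.pair 1 k)) ∧
      ∀ m : ℕ, (¬ G (Nat.pair 0 m.unpair.2) ≠ 0 → G (Nat.pair 3 m.unpair.2) = m.unpair.1 →
        ¬ G (Nat.pair 1 (Nat.pair 0 (assignUpdate x m.unpair.1 m.unpair.2))) ≠ 0) ∧
        (¬ G (Nat.pair 1 (Nat.pair 0 (assignUpdate x m.unpair.1 m.unpair.2))) ≠ 0 →
          ¬ G (Nat.pair 0 m.unpair.2) ≠ 0)

/-- The interpretation of two set variables by the supports of two functions. -/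
def supports (u v : ℕ → ℕ) : Fin 2 → Set ℕ := ![{n | u n ≠ 0}, {n | v n ≠ 0}]

theorem TruthTable.holds_iff {u v : ℕ → ℕ} (φ : Formula (Fin 2)) : ∀ {G : ℕ → ℕ},
    TruthTable u v φ G → ∀ c, G (Nat.pair 0 c) ≠ 0 ↔ φ.Holds (supports u v) (assign c) := by
  induction φ with
  | eq s t | lt s t => exact fun h => h
  | mem t X =>
    intro G h c
    rw [h c]
    fin_cases X <;> simp [Formula.Holds, supports]
  | neg A ih =>
    intro G h c
    rw [h.2 c]
    exact not_congr (ih h.1 c)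
  | and A B ihA ihB =>
    intro G h c
    rw [h.2 c]
    exact and_congr (ihA h.1.1 c) (ihB h.1.2 c)
  | or A B ihA ihB =>
    intro G h c
    rw [h.2 c]
    exact or_congr (ihA h.1.1 c) (ihB h.1.2 c)
  | imp A B ihA ihB =>
    intro G h c
    rw [h.2 c]
    exact imp_congr (ihA h.1.1 c) (ihB h.1.2 c)
  | ex x A ih =>
    intro G h c
    have hA (n : ℕ) := ih h.1 (assignUpdate x n c)
    simp only [assign_assignUpdate] at hA
    have h2 (n : ℕ) := h.2 (Nat.pair n c)
    simp only [Nat.unpair_pair, hA] at h2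
    exact ⟨fun hc => ⟨_, (h2 _).1 hc rfl⟩, fun ⟨n, hn⟩ => (h2 n).2 hn⟩
  | all x A ih =>
    intro G h c
    have hA (n : ℕ) := ih h.1 (assignUpdate x n c)
    simp only [assign_assignUpdate] at hA
    have h2 (n : ℕ) := h.2 (Nat.pair n c)
    simp only [Nat.unpair_pair, hA] at h2
    constructor
    · intro hc n
      by_contra hn
      exact (h2 n).2 hn hc
    · intro hc
      by_contra h0
      exact (h2 _).1 (not_not.2 h0) rfl (hc _)

open Classical in
theorem exists_truthTable (u v : ℕ → ℕ) (φ : Formula (Fin 2)) : ∃ G, TruthTable u v φ G := by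
  let V (φ : Formula (Fin 2)) (c : ℕ) : ℕ := if φ.Holds (supports u v) (assign c) then 1 else 0
  have hV (φ : Formula (Fin 2)) (c : ℕ) : V φ c ≠ 0 ↔ φ.Holds (supports u v) (assign c) := by
    simp [V]
  let mk (φ : Formula (Fin 2)) (G₁ G₂ G₃ : ℕ → ℕ) (k : ℕ) : ℕ :=
    if k.unpair.1 = 0 then V φ k.unpair.2 else if k.unpair.1 = 1 then G₁ k.unpair.2 else
      if k.unpair.1 = 2 then G₂ k.unpair.2 else G₃ k.unpair.2
  have mk0 (φ G₁ G₂ G₃ c) : mk φ G₁ G₂ G₃ (Nat.pair 0 c) = V φ c := by simp [mk]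
  have mk1 (φ G₁ G₂ G₃ c) : mk φ G₁ G₂ G₃ (Nat.pair 1 c) = G₁ c := by simp [mk]
  have mk2 (φ G₁ G₂ G₃ c) : mk φ G₁ G₂ G₃ (Nat.pair 2 c) = G₂ c := by simp [mk]
  have mk3 (φ G₁ G₂ G₃ c) : mk φ G₁ G₂ G₃ (Nat.pair 3 c) = G₃ c := by simp [mk]
  have hG {φ : Formula (Fin 2)} {G : ℕ → ℕ} (h : TruthTable u v φ G) := TruthTable.holds_iff φ h
  induction φ with
  | eq s t => exact ⟨mk (.eq s t) 0 0 0, fun c => by rw [mk0, hV]; rfl⟩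
  | lt s t => exact ⟨mk (.lt s t) 0 0 0, fun c => by rw [mk0, hV]; rfl⟩
  | mem t X =>
    refine ⟨mk (.mem t X) 0 0 0, fun c => ?_⟩
    rw [mk0, hV]
    fin_cases X <;> simp [Formula.Holds, supports]
  | neg A ih =>
    obtain ⟨G₁, h₁⟩ := ih
    refine ⟨mk (.neg A) G₁ 0 0, by simpa only [mk1] using h₁, fun c => ?_⟩
    rw [mk0, mk1, hV, hG h₁]
    rfl
  | and A B ihA ihB =>
    obtain ⟨G₁, h₁⟩ := ihA
    obtain ⟨G₂, h₂⟩ := ihB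
    refine ⟨mk (.and A B) G₁ G₂ 0, by simpa only [mk1, mk2] using ⟨h₁, h₂⟩, fun c => ?_⟩
    rw [mk0, mk1, mk2, hV, hG h₁, hG h₂]
    rfl
  | or A B ihA ihB =>
    obtain ⟨G₁, h₁⟩ := ihA
    obtain ⟨G₂, h₂⟩ := ihB
    refine ⟨mk (.or A B) G₁ G₂ 0, by simpa only [mk1, mk2] using ⟨h₁, h₂⟩, fun c => ?_⟩
    rw [mk0, mk1, mk2, hV, hG h₁, hG h₂]
    rfl
  | imp A B ihA ihB =>
    obtain ⟨G₁, h₁⟩ := ihA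
    obtain ⟨G₂, h₂⟩ := ihB
    refine ⟨mk (.imp A B) G₁ G₂ 0, by simpa only [mk1, mk2] using ⟨h₁, h₂⟩, fun c => ?_⟩
    rw [mk0, mk1, mk2, hV, hG h₁, hG h₂]
    rfl
  | ex x A ih =>
    obtain ⟨G₁, h₁⟩ := ih
    let w (c : ℕ) : ℕ := Classical.epsilon fun n =>
      A.Holds (supports u v) (Function.update (assign c) x n)
    refine ⟨mk (.ex x A) G₁ 0 w, by simpa only [mk1] using h₁, fun m => ?_⟩
    simp only [mk0, mk1, mk3, hV, hG h₁, assign_assignUpdate]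
    refine ⟨?_, fun h => ⟨_, h⟩⟩
    intro h hw
    rw [← hw]
    exact Classical.epsilon_spec h
  | all x A ih =>
    obtain ⟨G₁, h₁⟩ := ih
    let w (c : ℕ) : ℕ := Classical.epsilon fun n =>
      ¬ A.Holds (supports u v) (Function.update (assign c) x n)
    refine ⟨mk (.all x A) G₁ 0 w, by simpa only [mk1] using h₁, fun m => ?_⟩
    simp only [mk0, mk1, mk3, hV, hG h₁, assign_assignUpdate]
    refine ⟨?_, fun h h' => h (h' _)⟩
    intro h hw
    rw [← hw]
    exact Classical.epsilon_spec (not_forall.1 h)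

/-! ### Effectively closed conditions -/

/-- A condition on functions is locally checkable, uniformly in a parameter, if it is the
conjunction of a primitive recursive sequence of conditions on three values each. -/
def LocallyCheckable (P : ℕ → (ℕ → ℕ) → Prop) : Prop :=
  ∃ (i₁ i₂ i₃ : ℕ → ℕ) (C : ℕ → ℕ → ℕ → ℕ → ℕ → Prop),
    Primrec i₁ ∧ Primrec i₂ ∧ Primrec i₃ ∧
    PrimrecPred (fun x : ℕ × ℕ × ℕ × ℕ × ℕ => C x.1 x.2.1 x.2.2.1 x.2.2.2.1 x.2.2.2.2) ∧
    ∀ a h, P a h ↔ ∀ m, C a m (h (i₁ m)) (h (i₂ m)) (h (i₃ m))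

theorem LocallyCheckable.and {P Q : ℕ → (ℕ → ℕ) → Prop} (hP : LocallyCheckable P)
    (hQ : LocallyCheckable Q) : LocallyCheckable fun a h => P a h ∧ Q a h := by
  obtain ⟨i₁, i₂, i₃, C, h₁, h₂, h₃, hC, H⟩ := hP
  obtain ⟨j₁, j₂, j₃, D, k₁, k₂, k₃, hD, K⟩ := hQ
  have he : PrimrecPred fun m : ℕ => m % 2 = 0 :=
    Primrec.eq.comp (Primrec.nat_mod.comp Primrec.id (Primrec.const 2)) (Primrec.const 0)
  have hd : Primrec fun m : ℕ => m / 2 := Primrec.nat_div.comp Primrec.id (Primrec.const 2)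
  have hm : Primrec fun x : ℕ × ℕ × ℕ × ℕ × ℕ => x.2.1 := Primrec.fst.comp Primrec.snd
  have hx : Primrec fun x : ℕ × ℕ × ℕ × ℕ × ℕ => (x.1, x.2.1 / 2, x.2.2) :=
    Primrec.fst.pair ((hd.comp hm).pair (Primrec.snd.comp Primrec.snd))
  refine ⟨fun m => if m % 2 = 0 then i₁ (m / 2) else j₁ (m / 2),
    fun m => if m % 2 = 0 then i₂ (m / 2) else j₂ (m / 2),
    fun m => if m % 2 = 0 then i₃ (m / 2) else j₃ (m / 2),
    fun a m x y z => (m % 2 = 0 → C a (m / 2) x y z) ∧ (¬ m % 2 = 0 → D a (m / 2) x y z),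
    Primrec.ite he (h₁.comp hd) (k₁.comp hd), Primrec.ite he (h₂.comp hd) (k₂.comp hd),
    Primrec.ite he (h₃.comp hd) (k₃.comp hd),
    (PrimrecPred.imp' (he.comp hm) (hC.comp hx)).and
      (PrimrecPred.imp' (he.comp hm).not (hD.comp hx)), fun a h => ?_⟩
  beta_reduce
  rw [H, K]
  constructor
  · rintro ⟨h1, h2⟩ m
    by_cases hm : m % 2 = 0
    · simp only [hm, if_true, not_true, false_imp_iff, true_imp_iff, and_true]
      exact h1 _
    · simp only [hm, if_false, not_false_eq_true, false_imp_iff, true_imp_iff, true_and]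
      exact h2 _
  · intro hm
    refine ⟨fun m => ?_, fun m => ?_⟩
    · have := hm (2 * m)
      simpa using this
    · have := hm (2 * m + 1)
      simpa [Nat.add_mod, Nat.mul_add_div] using this

theorem LocallyCheckable.of_primrec {i₁ i₂ i₃ : ℕ → ℕ} {C : ℕ → ℕ → ℕ → ℕ → ℕ → Prop}
    (h₁ : Primrec i₁) (h₂ : Primrec i₂) (h₃ : Primrec i₃)
    (hC : PrimrecPred (fun x : ℕ × ℕ × ℕ × ℕ × ℕ => C x.1 x.2.1 x.2.2.1 x.2.2.2.1 x.2.2.2.2)) :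
    LocallyCheckable fun a h => ∀ m, C a m (h (i₁ m)) (h (i₂ m)) (h (i₃ m)) :=
  ⟨i₁, i₂, i₃, C, h₁, h₂, h₃, hC, fun _ _ => Iff.rfl⟩

section

variable {σ : Type*} [Primcodable σ]

theorem primrecPred_ne_zero {f : σ → ℕ} (hf : Primrec f) : PrimrecPred fun x => f x ≠ 0 :=
  (Primrec.eq.comp hf (Primrec.const 0)).not

theorem primrec_pair_left {f : σ → ℕ} (n : ℕ) (hf : Primrec f) :
    Primrec fun x => Nat.pair n (f x) :=
  Primrec₂.natPair.comp (Primrec.const n) hf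

end

/-- Reading `u`, `v` and `G` off one function along reindexings lets the induction pass to
subformulas by composing `s₃` with pairing. -/
theorem locallyCheckable_truthTable (φ : Formula (Fin 2)) : ∀ {s₁ s₂ s₃ : ℕ → ℕ},
    Primrec s₁ → Primrec s₂ → Primrec s₃ → LocallyCheckable fun _ h =>
      TruthTable (fun k => h (s₁ k)) (fun k => h (s₂ k)) φ (fun k => h (s₃ k)) := by
  have p0 : Primrec fun k => Nat.pair 0 k := primrec_pair_left 0 Primrec.id
  have p1 : Primrec fun k => Nat.pair 1 k := primrec_pair_left 1 Primrec.id
  have p2 : Primrec fun k => Nat.pair 2 k := primrec_pair_left 2 Primrec.id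
  have p3 : Primrec fun k => Nat.pair 3 k := primrec_pair_left 3 Primrec.id
  have q1 : Primrec fun k : ℕ => k.unpair.1 := Primrec.fst.comp Primrec.unpair
  have q2 : Primrec fun k : ℕ => k.unpair.2 := Primrec.snd.comp Primrec.unpair
  have xm : Primrec fun x : ℕ × ℕ × ℕ × ℕ × ℕ => x.2.1 := Primrec.fst.comp Primrec.snd
  have x1 : Primrec fun x : ℕ × ℕ × ℕ × ℕ × ℕ => x.2.2.1 :=
    Primrec.fst.comp (Primrec.snd.comp Primrec.snd)
  have x2 : Primrec fun x : ℕ × ℕ × ℕ × ℕ × ℕ => x.2.2.2.1 :=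
    Primrec.fst.comp (Primrec.snd.comp (Primrec.snd.comp Primrec.snd))
  have x3 : Primrec fun x : ℕ × ℕ × ℕ × ℕ × ℕ => x.2.2.2.2 :=
    Primrec.snd.comp (Primrec.snd.comp (Primrec.snd.comp Primrec.snd))
  induction φ with
  | eq s t =>
    intro s₁ s₂ s₃ _ _ h₃
    exact .of_primrec (C := fun _ m x _ _ => x ≠ 0 ↔ s.eval (assign m) = t.eval (assign m))
      (h₃.comp p0) (Primrec.const 0) (Primrec.const 0) (PrimrecPred.iff' (primrecPred_ne_zero x1)
      (Primrec.eq.comp ((primrec_eval_assign s).comp xm) ((primrec_eval_assign t).comp xm)))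
  | lt s t =>
    intro s₁ s₂ s₃ _ _ h₃
    exact .of_primrec (C := fun _ m x _ _ => x ≠ 0 ↔ s.eval (assign m) < t.eval (assign m))
      (h₃.comp p0) (Primrec.const 0) (Primrec.const 0) (PrimrecPred.iff' (primrecPred_ne_zero x1)
      (Primrec.nat_lt.comp ((primrec_eval_assign s).comp xm) ((primrec_eval_assign t).comp xm)))
  | mem t X =>
    intro s₁ s₂ s₃ h₁ h₂ h₃
    have hX : Primrec (if X = 0 then s₁ else s₂) := by split_ifs <;> assumption
    have := LocallyCheckable.of_primrec (C := fun _ _ x y _ => x ≠ 0 ↔ y ≠ 0)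
      (h₃.comp p0) (hX.comp (primrec_eval_assign t)) (Primrec.const 0)
      (PrimrecPred.iff' (primrecPred_ne_zero x1) (primrecPred_ne_zero x2))
    convert this using 5
    simp only [TruthTable]
    split_ifs <;> rfl
  | neg A ih =>
    intro s₁ s₂ s₃ h₁ h₂ h₃
    exact (ih h₁ h₂ (h₃.comp p1)).and (.of_primrec (C := fun _ _ x y _ => x ≠ 0 ↔ ¬ y ≠ 0)
      (h₃.comp p0) (h₃.comp (p1.comp p0)) (Primrec.const 0)
      (PrimrecPred.iff' (primrecPred_ne_zero x1) (primrecPred_ne_zero x2).not))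
  | and A B ihA ihB =>
    intro s₁ s₂ s₃ h₁ h₂ h₃
    exact ((ihA h₁ h₂ (h₃.comp p1)).and (ihB h₁ h₂ (h₃.comp p2))).and
      (.of_primrec (C := fun _ _ x y z => x ≠ 0 ↔ (y ≠ 0 ∧ z ≠ 0))
      (h₃.comp p0) (h₃.comp (p1.comp p0)) (h₃.comp (p2.comp p0))
      (PrimrecPred.iff' (primrecPred_ne_zero x1)
        ((primrecPred_ne_zero x2).and (primrecPred_ne_zero x3))))
  | or A B ihA ihB =>
    intro s₁ s₂ s₃ h₁ h₂ h₃
    exact ((ihA h₁ h₂ (h₃.comp p1)).and (ihB h₁ h₂ (h₃.comp p2))).and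
      (.of_primrec (C := fun _ _ x y z => x ≠ 0 ↔ (y ≠ 0 ∨ z ≠ 0))
      (h₃.comp p0) (h₃.comp (p1.comp p0)) (h₃.comp (p2.comp p0))
      (PrimrecPred.iff' (primrecPred_ne_zero x1)
        ((primrecPred_ne_zero x2).or (primrecPred_ne_zero x3))))
  | imp A B ihA ihB =>
    intro s₁ s₂ s₃ h₁ h₂ h₃
    exact ((ihA h₁ h₂ (h₃.comp p1)).and (ihB h₁ h₂ (h₃.comp p2))).and
      (.of_primrec (C := fun _ _ x y z => x ≠ 0 ↔ (y ≠ 0 → z ≠ 0))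
      (h₃.comp p0) (h₃.comp (p1.comp p0)) (h₃.comp (p2.comp p0))
      (PrimrecPred.iff' (primrecPred_ne_zero x1)
        (PrimrecPred.imp' (primrecPred_ne_zero x2) (primrecPred_ne_zero x3))))
  | ex v A ih =>
    intro s₁ s₂ s₃ h₁ h₂ h₃
    exact (ih h₁ h₂ (h₃.comp p1)).and (.of_primrec
      (C := fun _ m x y z => (x ≠ 0 → y = m.unpair.1 → z ≠ 0) ∧ (z ≠ 0 → x ≠ 0))
      (h₃.comp (p0.comp q2)) (h₃.comp (p3.comp q2))
      (h₃.comp (p1.comp (p0.comp ((primrec_assignUpdate v).comp Primrec.unpair))))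
      ((PrimrecPred.imp' (primrecPred_ne_zero x1) (PrimrecPred.imp'
        (Primrec.eq.comp x2 (q1.comp xm)) (primrecPred_ne_zero x3))).and
        (PrimrecPred.imp' (primrecPred_ne_zero x3) (primrecPred_ne_zero x1))))
  | all v A ih =>
    intro s₁ s₂ s₃ h₁ h₂ h₃
    exact (ih h₁ h₂ (h₃.comp p1)).and (.of_primrec
      (C := fun _ m x y z => (¬ x ≠ 0 → y = m.unpair.1 → ¬ z ≠ 0) ∧ (¬ z ≠ 0 → ¬ x ≠ 0))
      (h₃.comp (p0.comp q2)) (h₃.comp (p3.comp q2))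
      (h₃.comp (p1.comp (p0.comp ((primrec_assignUpdate v).comp Primrec.unpair))))
      ((PrimrecPred.imp' (primrecPred_ne_zero x1).not (PrimrecPred.imp'
        (Primrec.eq.comp x2 (q1.comp xm)) (primrecPred_ne_zero x3).not)).and
        (PrimrecPred.imp' (primrecPred_ne_zero x3).not (primrecPred_ne_zero x1).not)))

/-! ### Test sequences and the normal form of `Π¹₂` statements. -/

/-- The function with even part `f` and odd part `g`. -/
def interleave (f g : ℕ → ℕ) (k : ℕ) : ℕ := if k % 2 = 0 then f (k / 2) else g (k / 2)

@[simp] theorem interleave_two_mul (f g : ℕ → ℕ) (k : ℕ) : interleave f g (2 * k) = f k := by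
  simp [interleave]

@[simp] theorem interleave_two_mul_add_one (f g : ℕ → ℕ) (k : ℕ) :
    interleave f g (2 * k + 1) = g k := by
  simp [interleave, Nat.add_mod, Nat.mul_add_div]

/-- A primitive recursive sequence of tests, uniform in a parameter: the `m`-th test looks at three
values of a function. The test number `0` fails if these values are all `0`. -/
structure TestSequence where
  i₁ : ℕ → ℕ
  i₂ : ℕ → ℕ
  i₃ : ℕ → ℕ
  C : ℕ → ℕ → ℕ → ℕ → ℕ → Prop
  primrec_i₁ : Primrec i₁
  primrec_i₂ : Primrec i₂
  primrec_i₃ : Primrec i₃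
  primrec_C : PrimrecPred fun x : ℕ × ℕ × ℕ × ℕ × ℕ => C x.1 x.2.1 x.2.2.1 x.2.2.2.1 x.2.2.2.2
  not_C_zero : ∀ a, ¬ C a 0 0 0 0

/-- A function passes the tests if its values with the last binary digit dropped do. -/
def TestSequence.Passes (T : TestSequence) (a : ℕ) (h : ℕ → ℕ) : Prop :=
  ∀ m, T.C a m (h (T.i₁ m) / 2) (h (T.i₂ m) / 2) (h (T.i₃ m) / 2)

/-- The additional test number 0 makes three values below 2 a failing test for every parameter. This
serves as the trivial refutation of `honestPair`. -/
theorem LocallyCheckable.exists_testSequence {P : ℕ → (ℕ → ℕ) → Prop} (hP : LocallyCheckable P)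
    (j : ℕ) : ∃ T : TestSequence, ∀ a h, T.Passes a h ↔
      (h j / 2 ≠ 0 ∧ P a fun k => h k / 2) := by
  obtain ⟨i₁, i₂, i₃, C, h₁, h₂, h₃, hC, H⟩ := hP
  have hp {i : ℕ → ℕ} (hi : Primrec i) : Primrec fun m : ℕ => if m = 0 then j else i (m - 1) :=
    Primrec.ite (Primrec.eq.comp Primrec.id (Primrec.const 0)) (Primrec.const j)
      (hi.comp Primrec.pred)
  have hm : Primrec fun x : ℕ × ℕ × ℕ × ℕ × ℕ => x.2.1 := Primrec.fst.comp Primrec.snd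
  have hz : PrimrecPred fun x : ℕ × ℕ × ℕ × ℕ × ℕ => x.2.1 = 0 :=
    Primrec.eq.comp hm (Primrec.const 0)
  have hx : Primrec fun x : ℕ × ℕ × ℕ × ℕ × ℕ => (x.1, x.2.1 - 1, x.2.2) :=
    Primrec.fst.pair ((Primrec.pred.comp hm).pair (Primrec.snd.comp Primrec.snd))
  refine ⟨⟨_, _, _, fun a m x y z => (m = 0 → x ≠ 0) ∧ (¬ m = 0 → C a (m - 1) x y z),
    hp h₁, hp h₂, hp h₃, (PrimrecPred.imp' hz (primrecPred_ne_zero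
      (Primrec.fst.comp (Primrec.snd.comp Primrec.snd)))).and
      (PrimrecPred.imp' hz.not (hC.comp hx)), by simp⟩, fun a h => ?_⟩
  rw [H]
  constructor
  · intro hm
    exact ⟨by simpa using hm 0, fun m => by simpa using hm (m + 1)⟩
  · rintro ⟨h0, hs⟩ (_ | m)
    · simpa using h0
    · simpa using hs m

/-- The even part gives `X`; slices 0 and 1 of the odd part give `Y` and a truth table, and slice 2
satisfies test 0. -/
theorem exists_testSequence (φ : Formula (Fin 2)) (hφ : φ.freeVars ⊆ {0}) :
    ∃ T : TestSequence, ∀ a, (∀ X : Set ℕ, ∃ Y : Set ℕ, φ.Holds ![X, Y] (fun _ => a)) ↔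
      ∀ f, ∃ g, T.Passes a (interleave f g) := by
  have t0 : Primrec fun k : ℕ => 2 * k := Primrec.nat_mul.comp (Primrec.const 2) Primrec.id
  have t1 : Primrec fun k : ℕ => 2 * k + 1 := Primrec.succ.comp t0
  have hT := (locallyCheckable_truthTable φ t0 (t1.comp (primrec_pair_left 0 Primrec.id))
    (t1.comp (primrec_pair_left 1 Primrec.id))).and (.of_primrec
    -- Places cannot depend on `a` either, so all `m` are inspected and only the assignment code
    -- `⟨a, 0⟩` matters.
    (C := fun a m x _ _ => m = Nat.pair a 0 → x ≠ 0)
    (t1.comp (primrec_pair_left 1 (primrec_pair_left 0 Primrec.id))) (Primrec.const 0)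
    (Primrec.const 0) (PrimrecPred.imp' (Primrec.eq.comp (Primrec.fst.comp Primrec.snd)
      (Primrec₂.natPair.comp Primrec.fst (Primrec.const 0)))
      (primrecPred_ne_zero (Primrec.fst.comp (Primrec.snd.comp Primrec.snd)))))
  obtain ⟨T, hT⟩ := hT.exists_testSequence (2 * Nat.pair 2 0 + 1)
  refine ⟨T, fun a => ?_⟩
  have ha (I : Fin 2 → Set ℕ) :
      φ.Holds I (fun _ => a) ↔ φ.Holds I (assign (Nat.pair a 0)) := by
    refine φ.holds_congr fun x hx => ?_
    have := hφ hx
    rw [Finset.mem_singleton] at this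
    simp [this, assign]
  simp only [ha, hT]
  classical
  constructor
  · intro h f
    obtain ⟨Y, hY⟩ := h {n | f n / 2 ≠ 0}
    let v : ℕ → ℕ := fun n => if n ∈ Y then 1 else 0
    obtain ⟨G, hG⟩ := exists_truthTable (fun n => f n / 2) v φ
    have hv : {n | v n ≠ 0} = Y := by ext n; simp [v]
    have := hG.holds_iff φ (Nat.pair a 0)
    rw [supports, hv] at this
    -- Values are doubled because the tests halve them; the value 2 elsewhere satisfies test 0.
    refine ⟨fun k => if k.unpair.1 = 0 then 2 * v k.unpair.2 else if k.unpair.1 = 1 then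
      2 * G k.unpair.2 else 2, ?_⟩
    simp only [interleave_two_mul, interleave_two_mul_add_one, Nat.unpair_pair]
    norm_num
    exact ⟨hG, this.2 hY⟩
  · intro h X
    obtain ⟨g, -, hG, hg⟩ := h fun n => if n ∈ X then 2 else 0
    simp only [interleave_two_mul, interleave_two_mul_add_one] at hG hg
    have := hG.holds_iff φ (Nat.pair a 0)
    have hX : {n | (if n ∈ X then 2 else 0) / 2 ≠ 0} = X := by
      ext n
      by_cases hn : n ∈ X <;> simp [hn]
    rw [supports, hX] at this
    exact ⟨_, this.1 (hg _ rfl)⟩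

end ConstructiveTruth

namespace ConstructiveTruth

open Encodable

/-! ### Application of functions to functions -/

/-- The element coded by a number. -/
def ofCode (σ : Type*) [Encodable σ] [Inhabited σ] (n : ℕ) : σ := (decode n).getD default

@[simp] theorem ofCode_encode {σ : Type*} [Encodable σ] [Inhabited σ] (x : σ) :
    ofCode σ (encode x) = x := by
  simp [ofCode]

theorem primrec_ofCode {σ : Type*} [Primcodable σ] [Inhabited σ] : Primrec (ofCode σ) :=
  Primrec.option_getD.comp Primrec.decode (Primrec.const default)

theorem primrec_ofCode_entries : Primrec (ofCode (ℕ × ℕ × ℕ × ℕ)) := primrec_ofCode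

theorem primrec_ofCode_conflict : Primrec (ofCode ((ℕ × ℕ) × ℕ × List ℕ × ℕ)) := primrec_ofCode

theorem primrec_ofCode_answer : Primrec (ofCode ((ℕ × ℕ) × (List ℕ × ℕ) × ℕ × ℕ)) :=
  primrec_ofCode

theorem primrec_ofCode_query : Primrec (ofCode (ℕ × List ℕ)) := primrec_ofCode

attribute [irreducible] ofCode

/-- The initial segment of length `m` of a function. -/
def seg (β : ℕ → ℕ) (m : ℕ) : List ℕ := (List.range m).map β

@[simp] theorem length_seg (β : ℕ → ℕ) (m : ℕ) : (seg β m).length = m := by simp [seg]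

theorem take_seg (β : ℕ → ℕ) {k m : ℕ} (h : k ≤ m) : (seg β m).take k = seg β k := by
  simp [seg, ← List.map_take, List.take_range, h]

theorem getElem?_seg (β : ℕ → ℕ) {k m : ℕ} (h : k < m) : (seg β m)[k]? = some (β k) := by
  simp [seg, h]

theorem getElem?_seg_eq_some {β : ℕ → ℕ} {k m y : ℕ} (h : (seg β m)[k]? = some y) : β k = y := by
  by_cases hk : k < m
  · rwa [getElem?_seg β hk, Option.some.injEq] at h
  · simp [seg, hk] at h

theorem seg_congr {β β' : ℕ → ℕ} {m : ℕ} (h : ∀ k < m, β k = β' k) : seg β m = seg β' m :=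
  List.map_congr_left fun k hk => h k (List.mem_range.1 hk)

theorem seg_getD (σ : List ℕ) (t : ℕ) : seg (fun k => σ.getD k t) σ.length = σ := by
  refine List.ext_getElem (by simp) fun n h1 h2 => ?_
  simp [seg, h2]

/-- `Answers q σ d`: a functional with (partial) graph `q`, applied to functions with initial
segment `σ`, gives the value `d` at the argument `0` after having inspected exactly `σ`. -/
def Answers (q : ℕ → ℕ → Prop) (σ : List ℕ) (d : ℕ) : Prop :=
  q (encode ((0 : ℕ), σ)) (d + 1) ∧ ∀ k < σ.length, q (encode ((0 : ℕ), σ.take k)) 0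

theorem Answers.mono {q q' : ℕ → ℕ → Prop} {σ : List ℕ} {d : ℕ} (h : Answers q σ d)
    (H : ∀ z v, q z v → q' z v) : Answers q' σ d :=
  ⟨H _ _ h.1, fun k hk => H _ _ (h.2 k hk)⟩

theorem Applies.answers {α β γ : ℕ → ℕ} (h : Applies α β γ) :
    ∃ m, Answers (fun z v => α z = v) (seg β m) (γ 0) := by
  obtain ⟨m, h1, h2⟩ := h 0
  refine ⟨m, h1, fun k hk => ?_⟩
  rw [length_seg] at hk
  rw [take_seg _ hk.le]
  exact h2 k hk

theorem Answers.unique {α β : ℕ → ℕ} {m m' d d' : ℕ}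
    (h : Answers (fun z v => α z = v) (seg β m) d)
    (h' : Answers (fun z v => α z = v) (seg β m') d') : d = d' := by
  have key {m m' d d' : ℕ} (h : Answers (fun z v => α z = v) (seg β m) d)
      (h' : Answers (fun z v => α z = v) (seg β m') d') : ¬ m < m' := by
    intro hlt
    have h1 := h'.2 m (by simpa using hlt)
    have h2 := h.1
    rw [take_seg _ hlt.le] at h1
    omega
  obtain rfl : m = m' := by
    have := key h h'
    have := key h' h
    omega
  have h1 := h.1
  have h2 := h'.1
  omega

/-- An answer rests on finitely many values of `α`; `s` selects the part of `α` that serves as the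
functional. -/
theorem Answers.eventually {α : ℕ → ℕ} {s : ℕ → ℕ} {σ : List ℕ} {d : ℕ}
    (h : Answers (fun z v => α (s z) = v) σ d) :
    ∃ M, ∀ m ≥ M, Answers (fun z v => (seg α m)[s z]? = some v) σ d := by
  let N : ℕ := (Finset.range (σ.length + 1)).sup fun k => s (encode ((0 : ℕ), σ.take k))
  refine ⟨N + 1, fun m hm => ?_⟩
  have hN (k : ℕ) (hk : k ≤ σ.length) : s (encode ((0 : ℕ), σ.take k)) < m :=
    lt_of_lt_of_le (Nat.lt_succ_of_le (Finset.le_sup (f := fun k => s (encode ((0 : ℕ), σ.take k)))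
      (Finset.mem_range_succ_iff.2 hk))) hm
  refine ⟨?_, fun k hk => ?_⟩
  · have := hN σ.length le_rfl
    rw [List.take_length] at this
    exact (getElem?_seg _ this).trans (congrArg some h.1)
  · exact (getElem?_seg _ (hN k hk.le)).trans (congrArg some (h.2 k hk))

open Classical in
/-- The functional that waits for an initial segment `σ` such that `S σ d` for some `d` below its
length, or such that `w σ` is not zero, and then answers `d` or `w σ - 1`, respectively. -/
noncomputable def search (S : List ℕ → ℕ → Prop) (w : List ℕ → ℕ) (z : ℕ) : ℕ :=
  let x := ofCode (ℕ × List ℕ) z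
  if x.1 = 0 then
    let i := (List.range x.2.length).findIdx fun d => decide (S x.2 d)
    if i < x.2.length then i + 1 else w x.2
  else 1

theorem search_congr {S S' : List ℕ → ℕ → Prop} {w w' : List ℕ → ℕ} {z : ℕ}
    (hS : ∀ d, S (ofCode (ℕ × List ℕ) z).2 d ↔ S' (ofCode (ℕ × List ℕ) z).2 d)
    (hw : w (ofCode (ℕ × List ℕ) z).2 = w' (ofCode (ℕ × List ℕ) z).2) :
    search S w z = search S' w' z := by
  have hS' : (fun d => @decide (S (ofCode (ℕ × List ℕ) z).2 d) (Classical.propDecidable _)) =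
      fun d => @decide (S' (ofCode (ℕ × List ℕ) z).2 d) (Classical.propDecidable _) :=
    funext fun d => decide_eq_decide.2 (hS d)
  simp only [search, hw]
  rw [hS']

theorem search_spec {S : List ℕ → ℕ → Prop} {w : List ℕ → ℕ} {σ : List ℕ} {d : ℕ}
    (h : search S w (encode ((0 : ℕ), σ)) = d + 1) : S σ d ∨ w σ = d + 1 := by
  classical
  simp only [search, ofCode_encode, if_true] at h
  split_ifs at h with hi
  · left
    have h2 : (List.range σ.length).findIdx (fun d => decide (S σ d)) < (List.range σ.length).length := by
      simpa using hi
    have := List.findIdx_getElem (w := h2)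
    simp only [List.getElem_range, decide_eq_true_eq] at this
    rwa [Nat.succ_injective h] at this
  · exact Or.inr h

theorem search_ne_zero {S : List ℕ → ℕ → Prop} {w : List ℕ → ℕ} {σ : List ℕ}
    (h : (∃ d < σ.length, S σ d) ∨ w σ ≠ 0) : search S w (encode ((0 : ℕ), σ)) ≠ 0 := by
  classical
  simp only [search, ofCode_encode, if_true]
  split_ifs with hi
  · exact Nat.succ_ne_zero _
  · refine h.resolve_left ?_
    rintro ⟨d, hd, hS⟩
    refine hi ?_
    have := List.findIdx_lt_length_of_exists (xs := List.range σ.length)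
      (p := fun d => decide (S σ d)) ⟨d, by simpa using hd, by simpa using hS⟩
    simpa using this

/-- Bounding `d` by the length of the segment makes each step of the search finite and loses
nothing, since segments grow. -/
theorem applies_search {S : List ℕ → ℕ → Prop} {w : List ℕ → ℕ} {β : ℕ → ℕ}
    (h : ∃ m, (∃ d < m, S (seg β m) d) ∨ w (seg β m) ≠ 0) :
    ∃ γ, Applies (search S w) β γ ∧ ∃ m, S (seg β m) (γ 0) ∨ w (seg β m) = γ 0 + 1 := by
  classical
  have h' : ∃ m, search S w (encode ((0 : ℕ), seg β m)) ≠ 0 := by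
    obtain ⟨m, hm⟩ := h
    exact ⟨m, search_ne_zero (by simpa using hm)⟩
  have hm := Nat.find_spec h'
  obtain ⟨d, hd⟩ := Nat.exists_eq_succ_of_ne_zero hm
  refine ⟨fun n => if n = 0 then d else 0, fun n => ?_, Nat.find h', by simpa using search_spec hd⟩
  rcases Nat.eq_zero_or_pos n with rfl | hn
  · refine ⟨Nat.find h', by simpa [seg] using hd, fun k hk => ?_⟩
    have := Nat.find_min h' hk
    simpa [seg] using this
  · refine ⟨0, ?_, by simp⟩
    have : search S w (encode (n, ([] : List ℕ))) = 1 := by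
      unfold search
      simp only [ofCode_encode]
      rw [if_neg hn.ne']
    simpa [hn.ne'] using this

/-! ### Forbidden entries

A pair `p = (j, y)` forbids functions `h` with `h j = y`. -/

namespace TestSequence

variable (T : TestSequence) (a : ℕ)

/-- The three values of a function that are relevant for a test. -/
def entries (d : ℕ × ℕ × ℕ × ℕ) : List (ℕ × ℕ) :=
  [(T.i₁ d.1, d.2.1), (T.i₂ d.1, d.2.2.1), (T.i₃ d.1, d.2.2.2)]

/-- The values fail the test. -/
def Refutes (d : ℕ × ℕ × ℕ × ℕ) : Prop :=
  ¬ T.C a d.1 (d.2.1 / 2) (d.2.2.1 / 2) (d.2.2.2 / 2)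

/-- A failing test whose values are not forbidden. -/
def LegalRefutation (p : ℕ × ℕ) (d : ℕ × ℕ × ℕ × ℕ) : Prop :=
  T.Refutes a d ∧ p ∉ T.entries d

/-- The initial segment of a function `b` is compatible with the function with odd part
`k ↦ b ⟨k, 0⟩` avoiding `p`. -/
def _root_.ConstructiveTruth.OddAvoids (p : ℕ × ℕ) (σ : List ℕ) : Prop :=
  p.1 % 2 = 1 → σ[Nat.pair (p.1 / 2) 0]? ≠ some p.2

/-- `β` is a pair of an even part avoiding `p` and a functional that gives a legal refutation
for every odd part avoiding `p`. -/
def RefuterPair (p : ℕ × ℕ) (β : ℕ → ℕ) : Prop :=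
  (∀ x, p ≠ (2 * x, β (2 * Nat.pair x 0))) ∧
  ∀ b : ℕ → ℕ, (∀ x, p ≠ (2 * x + 1, b (Nat.pair x 0))) →
    ∃ γ, Applies (fun k => β (2 * k + 1)) b γ ∧ T.LegalRefutation a p (ofCode _ (γ 0))

/-- Evidence `((j, y'), y, σ, d)` that a refuter, which answers `d` to `σ`, is not honest: the
entry `(j, y')` of `d` conflicts with the even part, which takes the value `y` at `j`, or
with `σ`. -/
def Conflict (p : ℕ × ℕ) (e : (ℕ × ℕ) × ℕ × List ℕ × ℕ) : Prop :=
  (e.1.1 % 2 = 0 → p ≠ (e.1.1, e.2.1)) ∧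
  (OddAvoids p e.2.2.1 → T.LegalRefutation a p (ofCode _ e.2.2.2)) ∧
  e.1 ∈ T.entries (ofCode _ e.2.2.2) ∧ (e.1.1 % 2 = 0 → e.2.1 ≠ e.1.2) ∧ OddAvoids e.1 e.2.2.1

/-- `ξ` finds conflicts for all refuter pairs. -/
def ConflictFinder (p : ℕ × ℕ) (ξ : ℕ → ℕ) : Prop :=
  ∀ β, T.RefuterPair a p β → ∃ γ, Applies ξ β γ ∧ T.Conflict a p (ofCode _ (γ 0))

/-- The initial segment `l` of a refuter pair contains the conflict `e`. -/
def ShowsConflict (l : List ℕ) (e : (ℕ × ℕ) × ℕ × List ℕ × ℕ) : Prop :=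
  Answers (fun z v => l[2 * z + 1]? = some v) e.2.2.1 e.2.2.2 ∧
  e.1 ∈ T.entries (ofCode _ e.2.2.2) ∧
  (e.1.1 % 2 = 0 → l[2 * Nat.pair (e.1.1 / 2) 0]? = some e.2.1 ∧ e.2.1 ≠ e.1.2) ∧
  OddAvoids e.1 e.2.2.1

/-- The canonical conflict finder. -/
noncomputable def finder : ℕ → ℕ := search (fun l e => T.ShowsConflict l (ofCode _ e)) fun _ => 0

variable {T a}

/-- A last binary digit that avoids the forbidden value, whatever the other digits are. -/
theorem exists_ne_mod_two (y : ℕ) : ∃ s < 2, ∀ z, y ≠ 2 * z + s :=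
  ⟨(y + 1) % 2, Nat.mod_lt _ two_pos, fun z => by omega⟩

theorem Passes.congr {h h' : ℕ → ℕ} (hp : T.Passes a h) (H : ∀ k, h k / 2 = h' k / 2) :
    T.Passes a h' := fun m => by
  rw [← H, ← H, ← H]
  exact hp m

theorem exists_mem_entries_ne {h : ℕ → ℕ} (hp : T.Passes a h) {d : ℕ × ℕ × ℕ × ℕ}
    (hd : T.Refutes a d) : ∃ r ∈ T.entries d, h r.1 ≠ r.2 := by
  by_contra! H
  simp only [entries, List.mem_cons, List.not_mem_nil, or_false, forall_eq_or_imp, forall_eq] at H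
  refine hd ?_
  rw [← H.1, ← H.2.1, ← H.2.2]
  exact hp d.1

/-- Padding `σ` with a constant other than the forbidden value gives a function to which the refuter
must respond legally, and its answer depends on `σ` alone. -/
theorem RefuterPair.legalRefutation {p : ℕ × ℕ} {β : ℕ → ℕ} (hβ : T.RefuterPair a p β)
    {σ : List ℕ} (hσ : OddAvoids p σ) {d : ℕ}
    (hd : Answers (fun z v => β (2 * z + 1) = v) σ d) :
    T.LegalRefutation a p (ofCode _ d) := by
  obtain ⟨s, -, hs⟩ := exists_ne_mod_two p.2
  obtain ⟨γ, h1, h2⟩ := hβ.2 (fun k => σ.getD k s) fun x hx => by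
    rw [hx] at hσ
    simp only [OddAvoids] at hσ
    have hx2 : p.2 = σ.getD (Nat.pair x 0) s := by rw [hx]
    rw [Nat.mul_add_div two_pos] at hσ
    norm_num [Nat.add_mod] at hσ
    rcases h : σ[Nat.pair x 0]? with _ | y
    · rw [List.getD_eq_getElem?_getD, h] at hx2
      exact hs 0 (by simpa using hx2)
    · simp [h] at hσ
  obtain ⟨m, hm⟩ := h1.answers
  rw [← seg_getD σ s] at hd
  rwa [Answers.unique (α := fun k => β (2 * k + 1)) hd hm]

/-- If every even part has an odd part for which all tests are passed, the canonical conflict finder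
finds conflicts, whatever entry is forbidden. -/
theorem conflictFinder_finder (H : ∀ f, ∃ g, T.Passes a (interleave f g)) (p : ℕ × ℕ) :
    T.ConflictFinder a p T.finder := by
  intro β hβ
  let f (x : ℕ) : ℕ := β (2 * Nat.pair x 0)
  obtain ⟨g, hg⟩ := H f
  obtain ⟨s, hs2, hs⟩ := exists_ne_mod_two p.2
  -- Changing the last digits makes the odd part avoid `p` and leaves the tests unaffected.
  let g' (x : ℕ) : ℕ := 2 * (g x / 2) + s
  have hg' : T.Passes a (interleave f g') := hg.congr fun k => by
    simp only [interleave, g']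
    split_ifs <;> omega
  let b (k : ℕ) : ℕ := g' k.unpair.1
  have hb (x : ℕ) : b (Nat.pair x 0) = g' x := by simp [b]
  obtain ⟨γ, h1, h2⟩ := hβ.2 b fun x hx => by
    refine hs (g x / 2) ?_
    rw [hx, hb]
  obtain ⟨m, hm⟩ := h1.answers
  -- The refuter's answer fails a test that `interleave f g'` passes, so one of its entries is false
  -- for this function.
  obtain ⟨r, hr, hne⟩ := exists_mem_entries_ne hg' h2.1
  let e : (ℕ × ℕ) × ℕ × List ℕ × ℕ := (r, f (r.1 / 2), seg b m, γ 0)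
  have hodd : OddAvoids r (seg b m) := by
    intro hr1 hr2
    refine hne ?_
    have := getElem?_seg_eq_some hr2
    rw [hb] at this
    simp [interleave, hr1, this]
  have heven : r.1 % 2 = 0 → f (r.1 / 2) ≠ r.2 := by
    intro hr1
    simpa [interleave, hr1] using hne
  have hex : ∃ m, (∃ d < m, T.ShowsConflict (seg β m) (ofCode _ d)) ∨
      (fun _ : List ℕ => 0) (seg β m) ≠ 0 := by
    obtain ⟨M, hM⟩ := hm.eventually (α := β) (s := fun z => 2 * z + 1)
    let N := max M (max (encode e + 1) (2 * Nat.pair (r.1 / 2) 0 + 1))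
    refine ⟨N, Or.inl ⟨encode e, by simp only [N]; omega, ?_⟩⟩
    simp only [ofCode_encode]
    refine ⟨hM N (le_max_left _ _), hr, fun hr1 => ⟨?_, heven hr1⟩, hodd⟩
    exact getElem?_seg _ (by simp only [N, e]; omega)
  obtain ⟨γ', h3, m', h4⟩ := applies_search
    (S := fun l e => T.ShowsConflict l (ofCode _ e)) (w := fun _ => 0) hex
  refine ⟨γ', h3, ?_⟩
  have h4 := h4.resolve_right (Nat.succ_ne_zero _).symm
  obtain ⟨ha, hmem, hev, hod⟩ := h4
  -- The search may find another conflict, but what it reports is true of `β`; the clauses about `p`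
  -- hold because `β` is a refuter pair for `p`.
  refine ⟨fun hj hp => ?_, fun hσ => ?_, hmem, fun hj => (hev hj).2, hod⟩
  · refine hβ.1 ((ofCode ((ℕ × ℕ) × ℕ × List ℕ × ℕ) (γ' 0)).1.1 / 2) ?_
    rw [getElem?_seg_eq_some (hev hj).1, Nat.mul_div_cancel' (Nat.dvd_of_mod_eq_zero hj)]
    exact hp
  · exact hβ.legalRefutation hσ (ha.mono fun z v hz => getElem?_seg_eq_some hz)

/-! ### Honest refuters -/

variable (T a)

/-- The test values coded by `d` fail the test, and they are values of the function with even part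
`f` and odd part given by `σ`. -/
def HonestRefutation (f : ℕ → ℕ) (σ : List ℕ) (d : ℕ) : Prop :=
  T.Refutes a (ofCode _ d) ∧ ∀ r ∈ T.entries (ofCode _ d), r.1 / 2 < σ.length ∧
    (r.1 % 2 = 0 → f (r.1 / 2) = r.2) ∧ (r.1 % 2 = 1 → σ[Nat.pair (r.1 / 2) 0]? = some r.2)

/-- The even part `f` together with the functional that searches for an honest refutation, and
gives up, with a trivial refutation, when it has inspected at least `K` values. -/
noncomputable def honestPair (f : ℕ → ℕ) (t : ℕ) (K : Option ℕ) (k : ℕ) : ℕ :=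
  if k % 2 = 0 then f (k / 2).unpair.1 else
    search (T.HonestRefutation a f) (fun σ => if K.any (· ≤ σ.length) then
      encode (0, t, t, t) + 1 else 0) (k / 2)

/-- The honest pair given by a finite sequence, continued by the constant `t`. -/
noncomputable def finitePair (τ : List ℕ) (t : ℕ) : ℕ → ℕ :=
  T.honestPair a (fun x => τ.getD x t) t (some τ.length)

/-- The finite sequence `τ`, continued by the constant `t`, avoids `p`. -/
def _root_.ConstructiveTruth.EvenAvoids (p : ℕ × ℕ) (τ : List ℕ) (t : ℕ) : Prop :=
  t < 2 ∧ p.2 ≠ t ∧ (p.1 % 2 = 0 → τ[p.1 / 2]? ≠ some p.2)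

variable {T a}

/-- Honest entries are values of functions avoiding `p`, hence legal. The trivial refutation fails
test 0 since `t / 2 = 0`, and it is legal since `p.2 ≠ t`. If the functional never gives up, its
search ends because no odd part passes. -/
theorem refuterPair_honestPair {f : ℕ → ℕ} {t : ℕ} {K : Option ℕ} {p : ℕ × ℕ}
    (hf : ∀ x, p ≠ (2 * x, f x)) (ht : K ≠ none → t < 2 ∧ p.2 ≠ t)
    (hK : K = none → ∀ g, ¬ T.Passes a (interleave f g)) :
    T.RefuterPair a p (T.honestPair a f t K) := by
  refine ⟨fun x => by simpa [honestPair] using hf x, fun b hb => ?_⟩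
  have hodd : (fun k => T.honestPair a f t K (2 * k + 1)) = search (T.HonestRefutation a f)
      (fun σ => if K.any (· ≤ σ.length) then encode (0, t, t, t) + 1 else 0) := by
    funext k
    simp [honestPair, Nat.add_mod, Nat.mul_add_div]
  rw [hodd]
  obtain ⟨γ, h1, m, h2⟩ := applies_search (S := T.HonestRefutation a f)
    (w := fun σ => if K.any (· ≤ σ.length) then encode (0, t, t, t) + 1 else 0) (β := b) (by
      rcases K with _ | K
      · have := hK rfl fun x => b (Nat.pair x 0)
        simp only [Passes, not_forall] at this
        obtain ⟨m, hm⟩ := this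
        let h := interleave f fun x => b (Nat.pair x 0)
        let d : ℕ × ℕ × ℕ × ℕ := (m, h (T.i₁ m), h (T.i₂ m), h (T.i₃ m))
        -- A segment longer than the code of the refutation and every place that has to be
        -- inspected.
        let M := encode d + T.i₁ m + T.i₂ m + T.i₃ m + Nat.pair (T.i₁ m / 2) 0 +
          Nat.pair (T.i₂ m / 2) 0 + Nat.pair (T.i₃ m / 2) 0 + 1
        have key (j : ℕ) (hj : j < M) (hj' : Nat.pair (j / 2) 0 < M) : j / 2 < M ∧
            (j % 2 = 0 → f (j / 2) = h j) ∧
            (j % 2 = 1 → (seg b M)[Nat.pair (j / 2) 0]? = some (h j)) := by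
          refine ⟨by omega, fun h0 => by simp [h, interleave, h0], fun h1 => ?_⟩
          rw [getElem?_seg b hj']
          simp [h, interleave, h1]
        refine ⟨M, Or.inl ⟨encode d, by simp only [M]; omega, ?_⟩⟩
        simp only [HonestRefutation, ofCode_encode, entries, List.mem_cons, List.not_mem_nil,
          or_false, forall_eq_or_imp, forall_eq, length_seg]
        exact ⟨hm, key _ (by simp only [M, d]; omega) (by simp only [M, d]; omega),
          key _ (by simp only [M, d]; omega) (by simp only [M, d]; omega),
          key _ (by simp only [M, d]; omega) (by simp only [M, d]; omega)⟩
      · exact ⟨K, Or.inr (by simp)⟩)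
  refine ⟨γ, h1, ?_⟩
  rcases h2 with h2 | h2
  · refine ⟨h2.1, fun hp => ?_⟩
    obtain ⟨-, he, ho⟩ := h2.2 p hp
    rcases Nat.mod_two_eq_zero_or_one p.1 with h0 | h0
    · refine hf (p.1 / 2) ?_
      rw [he h0, Nat.mul_div_cancel' (Nat.dvd_of_mod_eq_zero h0)]
    · refine hb (p.1 / 2) ?_
      rw [getElem?_seg_eq_some (ho h0)]
      exact Prod.ext (by simp only; omega) rfl
  · rcases K with _ | K
    · simp at h2
    · obtain ⟨ht1, ht2⟩ := ht (by simp)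
      beta_reduce at h2
      split_ifs at h2
      rw [← Nat.succ_injective h2, ofCode_encode]
      refine ⟨?_, ?_⟩
      · have : t / 2 = 0 := by omega
        simpa [Refutes, this] using T.not_C_zero a
      · simp only [entries, List.mem_cons, List.not_mem_nil, or_false]
        rintro (h | h | h) <;> exact ht2 (by rw [h])

/-- A conflict finder gives correct answers to finite pairs. -/
theorem ConflictFinder.conflict {p : ℕ × ℕ} {ξ : ℕ → ℕ} (hξ : T.ConflictFinder a p ξ)
    {τ : List ℕ} {t m e : ℕ} (hτ : EvenAvoids p τ t)
    (he : Answers (fun z v => ξ z = v) (seg (T.finitePair a τ t) m) e) :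
    T.Conflict a p (ofCode _ e) := by
  obtain ⟨ht, hp, hτ⟩ := hτ
  obtain ⟨γ, h1, h2⟩ := hξ (T.finitePair a τ t) (refuterPair_honestPair (fun x hx => by
    rw [hx] at hτ hp
    simp only [Nat.mul_mod_right, true_imp_iff, Nat.mul_div_cancel_left x two_pos] at hτ hp
    rw [List.getD_eq_getElem?_getD] at hτ hp
    rcases h : τ[x]? with _ | y
    · simp [h] at hp
    · simp [h] at hτ) (fun _ => ⟨ht, hp⟩) (fun h => by simp at h))
  obtain ⟨m', hm'⟩ := h1.answers
  rwa [he.unique hm']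

/-- A query with number below `m` codes a list shorter than `m`: the functional does not yet give
up, and by the bound in `HonestRefutation` it looks only at values of `f` below `m`. -/
theorem seg_finitePair (f : ℕ → ℕ) (t t' m : ℕ) :
    seg (T.finitePair a (seg f m) t) m = seg (T.honestPair a f t' none) m := by
  refine seg_congr fun k hk => ?_
  have hf (x : ℕ) (hx : x < m) : (seg f m).getD x t = f x := by
    rw [List.getD_eq_getElem?_getD, getElem?_seg f hx, Option.getD_some]
  simp only [finitePair, honestPair, length_seg]
  have hk2 : k / 2 ≤ k := Nat.div_le_self _ _
  split_ifs with h
  · exact hf _ (lt_of_le_of_lt (Nat.unpair_left_le _) (by omega))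
  · have hlen : (ofCode (ℕ × List ℕ) (k / 2)).2.length < m := by
      refine lt_of_le_of_lt ?_ (lt_of_le_of_lt hk2 hk)
      rw [ofCode, decode_prod_val]
      rw [Denumerable.decode_eq_ofNat (List ℕ)]
      simp only [decode_nat, Option.bind_some, Option.map_some, Option.getD_some]
      refine (length_le_encode _).trans ((le_of_eq ?_).trans (Nat.unpair_right_le (k / 2)))
      exact Denumerable.encode_ofNat _
    refine search_congr (fun d => ?_) ?_
    · refine and_congr_right fun _ => forall₂_congr fun r _ => and_congr_right fun hr => ?_
      beta_reduce
      rw [hf _ (hr.trans hlen)]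
    · simp [hlen]

/-- If for some even part no odd part passes the tests, every alleged conflict finder gives an answer
that is wrong for some forbidden entry. -/
theorem ConflictFinder.exists_not_conflict {p : ℕ × ℕ} {ξ : ℕ → ℕ} (hξ : T.ConflictFinder a p ξ)
    {f₀ : ℕ → ℕ} (H : ∀ g, ¬ T.Passes a (interleave f₀ g)) : ∃ τ t m e p',
      Answers (fun z v => ξ z = v) (seg (T.finitePair a τ t) m) e ∧ EvenAvoids p' τ t ∧
      ¬ T.Conflict a p' (ofCode _ e) := by
  obtain ⟨s, hs2, hs⟩ := exists_ne_mod_two p.2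
  -- A version of `f₀` that avoids `p`.
  let f (x : ℕ) : ℕ := 2 * (f₀ x / 2) + s
  have hf (g : ℕ → ℕ) : ¬ T.Passes a (interleave f g) := fun hg => H g (hg.congr fun k => by
    simp only [interleave, f]
    split_ifs <;> omega)
  obtain ⟨γ, h1, h2⟩ := hξ (T.honestPair a f 0 none) (refuterPair_honestPair (fun x hx => by
    exact hs (f₀ x / 2) (by rw [hx])) (fun h => absurd rfl h) fun _ => hf)
  obtain ⟨m, hm⟩ := h1.answers
  -- If the disputed entry agrees with `f`, the value reported for `f` is false, and forbidding that
  -- value makes the answer wrong. Otherwise the disputed entry itself is forbidden: `f` and the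
  -- reported segment avoid it, so the reported refutation, which contains it, is illegal.
  suffices Hp : ∃ p' : ℕ × ℕ, (p'.1 % 2 = 0 → f (p'.1 / 2) ≠ p'.2) ∧
      ¬ T.Conflict a p' (ofCode _ (γ 0)) by
    obtain ⟨p', hp', hc⟩ := Hp
    obtain ⟨t, ht2, ht⟩ := exists_ne_mod_two p'.2
    refine ⟨seg f m, t, m, γ 0, p', by rwa [seg_finitePair f t 0 m],
      ⟨ht2, by simpa using ht 0, fun hj hj' => hp' hj (getElem?_seg_eq_some hj')⟩, hc⟩
  obtain ⟨-, -, hmem, hev, hod⟩ := h2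
  set e := ofCode ((ℕ × ℕ) × ℕ × List ℕ × ℕ) (γ 0) with he
  rcases Nat.mod_two_eq_zero_or_one e.1.1 with h0 | h0
  · by_cases hfe : f (e.1.1 / 2) = e.1.2
    · exact ⟨(e.1.1, e.2.1), fun _ => by rw [hfe]; exact (hev h0).symm, fun hc => hc.1 h0 rfl⟩
    · exact ⟨e.1, fun _ => hfe, fun hc => (hc.2.1 hod).2 hmem⟩
  · exact ⟨e.1, fun h => by omega, fun hc => (hc.2.1 hod).2 hmem⟩

end TestSequence

end ConstructiveTruth

namespace ConstructiveTruth

open Encodable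

/-! ### Computability of the search functionals -/

section

variable {ρ : Type*} [Primcodable ρ]

theorem primrec_seg {f : ρ → ℕ → ℕ} (hf : Primrec₂ f) : Primrec₂ fun x m => seg (f x) m :=
  Primrec.list_map (Primrec.list_range.comp Primrec.snd)
    (hf.comp (Primrec.fst.comp Primrec.fst) Primrec.snd)

theorem primrec_query : Primrec fun σ : List ℕ => encode ((0 : ℕ), σ) :=
  Primrec.encode.comp ((Primrec.const 0).pair Primrec.id)

theorem primrec_search {S : ρ → List ℕ → ℕ → Prop} {w : ρ → List ℕ → ℕ}
    (hS : PrimrecPred fun x : ρ × List ℕ × ℕ => S x.1 x.2.1 x.2.2) (hw : Primrec₂ w) :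
    Primrec₂ fun x z => search (S x) (w x) z := by
  classical
  have hl : Primrec fun x : ρ × ℕ => (ofCode (ℕ × List ℕ) x.2).2 :=
    Primrec.snd.comp (primrec_ofCode_query.comp Primrec.snd)
  have hi : Primrec fun x : ρ × ℕ => (List.range (ofCode (ℕ × List ℕ) x.2).2.length).findIdx
      fun d => decide (S x.1 (ofCode (ℕ × List ℕ) x.2).2 d) :=
    Primrec.list_findIdx (Primrec.list_range.comp (Primrec.list_length.comp hl))
      (hS.comp ((Primrec.fst.comp Primrec.fst).pair
        ((hl.comp Primrec.fst).pair Primrec.snd))).decide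
  refine (Primrec.ite (c := fun x : ρ × ℕ => (ofCode (ℕ × List ℕ) x.2).1 = 0)
    (Primrec.eq.comp (Primrec.fst.comp (primrec_ofCode_query.comp Primrec.snd)) (Primrec.const 0))
    (Primrec.ite (Primrec.nat_lt.comp hi (Primrec.list_length.comp hl)) (Primrec.succ.comp hi)
      (hw.comp Primrec.fst hl)) (Primrec.const 1)).of_eq fun x => ?_
  simp only [search, Nat.succ_eq_add_one]

theorem primrecPred_answers {s : ℕ → ℕ} (hs : Primrec s) :
    PrimrecPred fun x : List ℕ × List ℕ × ℕ =>
      Answers (fun z v => x.1[s z]? = some v) x.2.1 x.2.2 := by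
  have hq : Primrec fun σ : List ℕ => s (encode ((0 : ℕ), σ)) := hs.comp primrec_query
  have h1 : PrimrecPred fun x : List ℕ × List ℕ × ℕ =>
      x.1[s (encode ((0 : ℕ), x.2.1))]? = some (x.2.2 + 1) :=
    Primrec.eq.comp (Primrec.list_getElem?.comp Primrec.fst
      (hq.comp (Primrec.fst.comp Primrec.snd)))
      (Primrec.option_some.comp (Primrec.succ.comp (Primrec.snd.comp Primrec.snd)))
  have h2 : PrimrecRel fun (k : ℕ) (x : List ℕ × List ℕ × ℕ) =>
      x.1[s (encode ((0 : ℕ), x.2.1.take k))]? = some 0 :=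
    Primrec.eq.comp (Primrec.list_getElem?.comp (Primrec.fst.comp Primrec.snd)
      (hq.comp (Primrec.list_take.comp Primrec.fst
        (Primrec.fst.comp (Primrec.snd.comp Primrec.snd))))) (Primrec.const (some 0))
  have h3 := h2.forall_mem_list.comp
    (Primrec.list_range.comp (Primrec.list_length.comp (Primrec.fst.comp Primrec.snd))) Primrec.id
  exact (h1.and h3).of_eq fun x => by simp [Answers]

theorem primrecPred_oddAvoids :
    PrimrecPred fun x : (ℕ × ℕ) × List ℕ => OddAvoids x.1 x.2 := by
  have hj : Primrec fun x : (ℕ × ℕ) × List ℕ => x.1.1 := Primrec.fst.comp Primrec.fst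
  exact PrimrecPred.imp' (Primrec.eq.comp (Primrec.nat_mod.comp hj (Primrec.const 2))
    (Primrec.const 1)) (Primrec.eq.comp (Primrec.list_getElem?.comp Primrec.snd
      (Primrec₂.natPair.comp (Primrec.nat_div.comp hj (Primrec.const 2)) (Primrec.const 0)))
      (Primrec.option_some.comp (Primrec.snd.comp Primrec.fst))).not

theorem primrecPred_evenAvoids :
    PrimrecPred fun x : (ℕ × ℕ) × List ℕ × ℕ => EvenAvoids x.1 x.2.1 x.2.2 := by
  have hj : Primrec fun x : (ℕ × ℕ) × List ℕ × ℕ => x.1.1 := Primrec.fst.comp Primrec.fst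
  have hy : Primrec fun x : (ℕ × ℕ) × List ℕ × ℕ => x.1.2 := Primrec.snd.comp Primrec.fst
  have ht : Primrec fun x : (ℕ × ℕ) × List ℕ × ℕ => x.2.2 := Primrec.snd.comp Primrec.snd
  exact (Primrec.nat_lt.comp ht (Primrec.const 2)).and ((Primrec.eq.comp hy ht).not.and
    (PrimrecPred.imp' (Primrec.eq.comp (Primrec.nat_mod.comp hj (Primrec.const 2))
      (Primrec.const 0)) (Primrec.eq.comp (Primrec.list_getElem?.comp
        (Primrec.fst.comp Primrec.snd) (Primrec.nat_div.comp hj (Primrec.const 2)))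
        (Primrec.option_some.comp hy)).not))

end

namespace TestSequence

variable (T : TestSequence)

theorem primrec_entries : Primrec T.entries := by
  have h2 : Primrec fun d : ℕ × ℕ × ℕ × ℕ => d.2.1 := Primrec.fst.comp Primrec.snd
  have h3 : Primrec fun d : ℕ × ℕ × ℕ × ℕ => d.2.2.1 :=
    Primrec.fst.comp (Primrec.snd.comp Primrec.snd)
  have h4 : Primrec fun d : ℕ × ℕ × ℕ × ℕ => d.2.2.2 :=
    Primrec.snd.comp (Primrec.snd.comp Primrec.snd)
  exact Primrec.list_cons.comp ((T.primrec_i₁.comp Primrec.fst).pair h2)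
    (Primrec.list_cons.comp ((T.primrec_i₂.comp Primrec.fst).pair h3)
      (Primrec.list_cons.comp ((T.primrec_i₃.comp Primrec.fst).pair h4) (Primrec.const [])))

theorem primrecPred_mem_entries :
    PrimrecPred fun x : (ℕ × ℕ) × ℕ × ℕ × ℕ × ℕ => x.1 ∈ T.entries x.2 := by
  have : PrimrecRel fun (L : List (ℕ × ℕ)) (p : ℕ × ℕ) => ∃ r ∈ L, r = p :=
    PrimrecRel.exists_mem_list Primrec.eq
  exact (this.comp (T.primrec_entries.comp Primrec.snd) Primrec.fst).of_eq fun x => by simp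

theorem primrecPred_refutes :
    PrimrecPred fun x : ℕ × ℕ × ℕ × ℕ × ℕ => T.Refutes x.1 x.2 := by
  have hd {f : ℕ × ℕ × ℕ × ℕ × ℕ → ℕ} (hf : Primrec f) : Primrec fun x => f x / 2 :=
    Primrec.nat_div.comp hf (Primrec.const 2)
  have h2 : Primrec fun x : ℕ × ℕ × ℕ × ℕ × ℕ => x.2.2.1 :=
    Primrec.fst.comp (Primrec.snd.comp Primrec.snd)
  have h3 : Primrec fun x : ℕ × ℕ × ℕ × ℕ × ℕ => x.2.2.2.1 :=
    Primrec.fst.comp (Primrec.snd.comp (Primrec.snd.comp Primrec.snd))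
  have h4 : Primrec fun x : ℕ × ℕ × ℕ × ℕ × ℕ => x.2.2.2.2 :=
    Primrec.snd.comp (Primrec.snd.comp (Primrec.snd.comp Primrec.snd))
  exact (T.primrec_C.comp (Primrec.fst.pair ((Primrec.fst.comp Primrec.snd).pair
    ((hd h2).pair ((hd h3).pair (hd h4)))))).not

theorem primrecPred_legalRefutation :
    PrimrecPred fun x : ℕ × (ℕ × ℕ) × ℕ × ℕ × ℕ × ℕ => T.LegalRefutation x.1 x.2.1 x.2.2 :=
  (T.primrecPred_refutes.comp (Primrec.fst.pair (Primrec.snd.comp Primrec.snd))).and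
    (T.primrecPred_mem_entries.comp Primrec.snd).not

theorem primrecPred_conflict :
    PrimrecPred fun x : ℕ × (ℕ × ℕ) × (ℕ × ℕ) × ℕ × List ℕ × ℕ =>
      T.Conflict x.1 x.2.1 x.2.2 := by
  have hp : Primrec fun x : ℕ × (ℕ × ℕ) × (ℕ × ℕ) × ℕ × List ℕ × ℕ => x.2.1 :=
    Primrec.fst.comp Primrec.snd
  have he : Primrec fun x : ℕ × (ℕ × ℕ) × (ℕ × ℕ) × ℕ × List ℕ × ℕ => x.2.2 :=
    Primrec.snd.comp Primrec.snd
  have hr := Primrec.fst.comp he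
  have hj := Primrec.fst.comp hr
  have hy := Primrec.fst.comp (Primrec.snd.comp he)
  have hσ := Primrec.fst.comp (Primrec.snd.comp (Primrec.snd.comp he))
  have hd := primrec_ofCode_entries.comp (Primrec.snd.comp (Primrec.snd.comp (Primrec.snd.comp he)))
  have hev := Primrec.eq.comp (Primrec.nat_mod.comp hj (Primrec.const 2)) (Primrec.const 0)
  have h1 := PrimrecPred.imp' hev (Primrec.eq.comp hp (hj.pair hy)).not
  have h2 := PrimrecPred.imp' (primrecPred_oddAvoids.comp (hp.pair hσ))
      (T.primrecPred_legalRefutation.comp (Primrec.fst.pair (hp.pair hd)))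
  have h3 := T.primrecPred_mem_entries.comp (hr.pair hd)
  have h4 := PrimrecPred.imp' hev (Primrec.eq.comp hy (Primrec.snd.comp hr)).not
  have h5 := primrecPred_oddAvoids.comp (hr.pair hσ)
  exact h1.and (h2.and (h3.and (h4.and h5)))

theorem primrecPred_showsConflict :
    PrimrecPred fun x : List ℕ × (ℕ × ℕ) × ℕ × List ℕ × ℕ => T.ShowsConflict x.1 x.2 := by
  have he : Primrec fun x : List ℕ × (ℕ × ℕ) × ℕ × List ℕ × ℕ => x.2 := Primrec.snd
  have hr := Primrec.fst.comp he
  have hj := Primrec.fst.comp hr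
  have hy := Primrec.fst.comp (Primrec.snd.comp he)
  have hσ := Primrec.fst.comp (Primrec.snd.comp (Primrec.snd.comp he))
  have hd := Primrec.snd.comp (Primrec.snd.comp (Primrec.snd.comp he))
  have hev := Primrec.eq.comp (Primrec.nat_mod.comp hj (Primrec.const 2)) (Primrec.const 0)
  have h2 : Primrec fun k : ℕ => 2 * k := Primrec.nat_mul.comp (Primrec.const 2) Primrec.id
  have h1 := (primrecPred_answers (Primrec.succ.comp h2)).comp (Primrec.fst.pair (hσ.pair hd))
  have h3 := T.primrecPred_mem_entries.comp (hr.pair (primrec_ofCode_entries.comp hd))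
  have h4 := Primrec.eq.comp (Primrec.list_getElem?.comp
    (Primrec.fst (α := List ℕ) (β := (ℕ × ℕ) × ℕ × List ℕ × ℕ))
      (h2.comp (Primrec₂.natPair.comp (Primrec.nat_div.comp hj (Primrec.const 2))
        (Primrec.const 0)))) (Primrec.option_some.comp hy)
  have h5 := (Primrec.eq.comp hy (Primrec.snd.comp hr)).not
  have h6 := primrecPred_oddAvoids.comp (hr.pair hσ)
  exact h1.and (h3.and ((PrimrecPred.imp' hev (h4.and h5)).and h6))

theorem primrec_finder : Primrec T.finder :=
  (primrec_search (ρ := Unit) (S := fun _ l e => T.ShowsConflict l (ofCode _ e))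
    (w := fun _ _ => 0) (T.primrecPred_showsConflict.comp ((Primrec.fst.comp Primrec.snd).pair
      (primrec_ofCode_conflict.comp (Primrec.snd.comp Primrec.snd)))) (Primrec.const 0).to₂).comp
    (Primrec.const ()) Primrec.id

theorem primrecPred_honestRefutation :
    PrimrecPred fun x : (ℕ × List ℕ × ℕ) × List ℕ × ℕ =>
      T.HonestRefutation x.1.1 (fun k => x.1.2.1.getD k x.1.2.2) x.2.1 x.2.2 := by
  have hd : Primrec fun x : (ℕ × List ℕ × ℕ) × List ℕ × ℕ => ofCode (ℕ × ℕ × ℕ × ℕ) x.2.2 :=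
    primrec_ofCode_entries.comp (Primrec.snd.comp Primrec.snd)
  have hr : Primrec fun y : (ℕ × ℕ) × (ℕ × List ℕ × ℕ) × List ℕ × ℕ => y.1 := Primrec.fst
  have hj := Primrec.fst.comp hr
  have hv := Primrec.snd.comp hr
  have hσ : Primrec fun y : (ℕ × ℕ) × (ℕ × List ℕ × ℕ) × List ℕ × ℕ => y.2.2.1 :=
    Primrec.fst.comp (Primrec.snd.comp Primrec.snd)
  have hτ : Primrec fun y : (ℕ × ℕ) × (ℕ × List ℕ × ℕ) × List ℕ × ℕ => y.2.1.2.1 :=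
    Primrec.fst.comp (Primrec.snd.comp (Primrec.fst.comp Primrec.snd))
  have ht : Primrec fun y : (ℕ × ℕ) × (ℕ × List ℕ × ℕ) × List ℕ × ℕ => y.2.1.2.2 :=
    Primrec.snd.comp (Primrec.snd.comp (Primrec.fst.comp Primrec.snd))
  have hj2 := Primrec.nat_div.comp hj (Primrec.const 2)
  have hjm := Primrec.nat_mod.comp hj (Primrec.const 2)
  have hR : PrimrecRel fun (r : ℕ × ℕ) (x : (ℕ × List ℕ × ℕ) × List ℕ × ℕ) =>
      r.1 / 2 < x.2.1.length ∧ (r.1 % 2 = 0 → (x.1.2.1[r.1 / 2]?).getD x.1.2.2 = r.2) ∧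
        (r.1 % 2 = 1 → x.2.1[Nat.pair (r.1 / 2) 0]? = some r.2) :=
    (Primrec.nat_lt.comp hj2 (Primrec.list_length.comp hσ)).and
      ((PrimrecPred.imp' (Primrec.eq.comp hjm (Primrec.const 0)) (Primrec.eq.comp
        (Primrec.option_getD.comp (Primrec.list_getElem?.comp hτ hj2) ht) hv)).and
      (PrimrecPred.imp' (Primrec.eq.comp hjm (Primrec.const 1)) (Primrec.eq.comp
        (Primrec.list_getElem?.comp hσ (Primrec₂.natPair.comp hj2 (Primrec.const 0)))
        (Primrec.option_some.comp hv))))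
  refine ((T.primrecPred_refutes.comp ((Primrec.fst.comp Primrec.fst).pair hd)).and
    (hR.forall_mem_list.comp (T.primrec_entries.comp hd) Primrec.id)).of_eq fun x => ?_
  simp only [HonestRefutation, List.getD_eq_getElem?_getD]
  rfl

theorem primrec_finitePair :
    Primrec₂ fun (x : ℕ × List ℕ × ℕ) k => T.finitePair x.1 x.2.1 x.2.2 k := by
  have hk2 : Primrec fun y : (ℕ × List ℕ × ℕ) × ℕ => y.2 / 2 :=
    Primrec.nat_div.comp Primrec.snd (Primrec.const 2)
  have hτ : Primrec fun y : (ℕ × List ℕ × ℕ) × ℕ => y.1.2.1 :=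
    Primrec.fst.comp (Primrec.snd.comp Primrec.fst)
  have ht : Primrec fun y : (ℕ × List ℕ × ℕ) × ℕ => y.1.2.2 :=
    Primrec.snd.comp (Primrec.snd.comp Primrec.fst)
  have hw : Primrec₂ fun (x : ℕ × List ℕ × ℕ) (σ : List ℕ) =>
      if x.2.1.length ≤ σ.length then encode (0, x.2.2, x.2.2, x.2.2) + 1 else 0 := by
    have ht : Primrec fun y : (ℕ × List ℕ × ℕ) × List ℕ => y.1.2.2 :=
      Primrec.snd.comp (Primrec.snd.comp Primrec.fst)
    exact Primrec.ite (Primrec.nat_le.comp (Primrec.list_length.comp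
      (Primrec.fst.comp (Primrec.snd.comp Primrec.fst))) (Primrec.list_length.comp Primrec.snd))
      (Primrec.succ.comp (Primrec.encode.comp ((Primrec.const 0).pair (ht.pair (ht.pair ht)))))
      (Primrec.const 0)
  have hs := primrec_search (S := fun (x : ℕ × List ℕ × ℕ) =>
    T.HonestRefutation x.1 fun k => x.2.1.getD k x.2.2) T.primrecPred_honestRefutation hw
  refine (Primrec.ite (Primrec.eq.comp (Primrec.nat_mod.comp Primrec.snd (Primrec.const 2))
    (Primrec.const 0)) (Primrec.option_getD.comp (Primrec.list_getElem?.comp hτ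
      (Primrec.fst.comp (Primrec.unpair.comp hk2))) ht) (hs.comp Primrec.fst hk2)).of_eq
    fun y => ?_
  simp [finitePair, honestPair, List.getD_eq_getElem?_getD]

/-- Given a functional with graph `q`, the answer `e` to a finite pair is wrong if the entry `p` is
forbidden. Here `c = ((τ, t), m, e)`. -/
def WrongAnswer (a : ℕ) (q : ℕ → ℕ → Prop) (p : ℕ × ℕ) (c : (List ℕ × ℕ) × ℕ × ℕ) : Prop :=
  Answers q (seg (T.finitePair a c.1.1 c.1.2) c.2.1) c.2.2 ∧ EvenAvoids p c.1.1 c.1.2 ∧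
    ¬ T.Conflict a p (ofCode _ c.2.2)

theorem primrec_seg_finitePair :
    Primrec fun x : ℕ × (List ℕ × ℕ) × ℕ => seg (T.finitePair x.1 x.2.1.1 x.2.1.2) x.2.2 :=
  (primrec_seg T.primrec_finitePair).comp
    (Primrec.fst.pair (Primrec.fst.comp Primrec.snd)) (Primrec.snd.comp Primrec.snd)

theorem primrecPred_isWrong : PrimrecPred fun x : ℕ × (ℕ × ℕ) × (List ℕ × ℕ) × ℕ × ℕ =>
    EvenAvoids x.2.1 x.2.2.1.1 x.2.2.1.2 ∧ ¬ T.Conflict x.1 x.2.1 (ofCode _ x.2.2.2.2) := by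
  have hp : Primrec fun x : ℕ × (ℕ × ℕ) × (List ℕ × ℕ) × ℕ × ℕ => x.2.1 :=
    Primrec.fst.comp Primrec.snd
  have hτ : Primrec fun x : ℕ × (ℕ × ℕ) × (List ℕ × ℕ) × ℕ × ℕ => x.2.2.1 :=
    Primrec.fst.comp (Primrec.snd.comp Primrec.snd)
  have he : Primrec fun x : ℕ × (ℕ × ℕ) × (List ℕ × ℕ) × ℕ × ℕ => x.2.2.2.2 :=
    Primrec.snd.comp (Primrec.snd.comp (Primrec.snd.comp Primrec.snd))
  exact (primrecPred_evenAvoids.comp (hp.pair hτ)).and (T.primrecPred_conflict.comp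
    (Primrec.fst.pair (hp.pair (primrec_ofCode_conflict.comp he)))).not

theorem primrecPred_wrongAnswer (a : ℕ) : PrimrecPred fun x : List ℕ × ℕ =>
    let c := ofCode ((ℕ × ℕ) × (List ℕ × ℕ) × ℕ × ℕ) x.2
    T.WrongAnswer a (fun z v => x.1[z]? = some v) c.1 c.2 := by
  have hc : Primrec fun x : List ℕ × ℕ => ofCode ((ℕ × ℕ) × (List ℕ × ℕ) × ℕ × ℕ) x.2 :=
    primrec_ofCode_answer.comp Primrec.snd
  have h2 := Primrec.snd.comp hc
  have h22 := Primrec.snd.comp h2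
  have h3 := T.primrec_seg_finitePair.comp
    ((Primrec.const a).pair ((Primrec.fst.comp h2).pair (Primrec.fst.comp h22)))
  have h4 := (primrecPred_answers Primrec.id).comp (Primrec.fst.pair (h3.pair
    (Primrec.snd.comp h22)))
  have h5 := T.primrecPred_isWrong.comp ((Primrec.const a).pair hc)
  exact h4.and h5

/-- The functional that searches for a wrong answer of an alleged conflict finder. -/
noncomputable def exposer (a : ℕ) : ℕ → ℕ := search (fun l c =>
  T.WrongAnswer a (fun z v => l[z]? = some v) (ofCode ((ℕ × ℕ) × (List ℕ × ℕ) × ℕ × ℕ) c).1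
    (ofCode ((ℕ × ℕ) × (List ℕ × ℕ) × ℕ × ℕ) c).2) fun _ => 0

theorem primrec_exposer (a : ℕ) : Primrec (T.exposer a) :=
  (primrec_search (ρ := Unit) (S := fun _ l c => T.WrongAnswer a (fun z v => l[z]? = some v)
    (ofCode ((ℕ × ℕ) × (List ℕ × ℕ) × ℕ × ℕ) c).1 (ofCode ((ℕ × ℕ) × (List ℕ × ℕ) × ℕ × ℕ) c).2)
    (w := fun _ _ => 0) ((T.primrecPred_wrongAnswer a).comp Primrec.snd) (Primrec.const 0).to₂).comp
    (Primrec.const ()) Primrec.id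

/-- The number `c` codes an answer that is correct if `p` is forbidden but wrong if the entry
given by `c` is forbidden. -/
def Exposes (a : ℕ) (p : ℕ × ℕ) (c : (ℕ × ℕ) × (List ℕ × ℕ) × ℕ × ℕ) : Prop :=
  (EvenAvoids p c.2.1.1 c.2.1.2 → T.Conflict a p (ofCode _ c.2.2.2)) ∧
    EvenAvoids c.1 c.2.1.1 c.2.1.2 ∧ ¬ T.Conflict a c.1 (ofCode _ c.2.2.2)

theorem primrecPred_exposes :
    PrimrecPred fun x : ℕ × (ℕ × ℕ) × (ℕ × ℕ) × (List ℕ × ℕ) × ℕ × ℕ =>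
      T.Exposes x.1 x.2.1 x.2.2 := by
  have hp : Primrec fun x : ℕ × (ℕ × ℕ) × (ℕ × ℕ) × (List ℕ × ℕ) × ℕ × ℕ => x.2.1 :=
    Primrec.fst.comp Primrec.snd
  have hc : Primrec fun x : ℕ × (ℕ × ℕ) × (ℕ × ℕ) × (List ℕ × ℕ) × ℕ × ℕ => x.2.2 :=
    Primrec.snd.comp Primrec.snd
  have hτ := Primrec.fst.comp (Primrec.snd.comp hc)
  have he := primrec_ofCode_conflict.comp
    (Primrec.snd.comp (Primrec.snd.comp (Primrec.snd.comp hc)))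
  have h1 := primrecPred_evenAvoids.comp (hp.pair hτ)
  have h2 := T.primrecPred_conflict.comp (Primrec.fst.pair (hp.pair he))
  have h3 := T.primrecPred_isWrong.comp (Primrec.fst.pair hc)
  exact (PrimrecPred.imp' h1 h2).and h3

variable {T} {a : ℕ}

/-- The wrong answer shows up in some initial segment of `ξ`. The one that is found is right for
`p`, as it is an answer of `ξ` to a finite pair. -/
theorem ConflictFinder.applies_exposer {p : ℕ × ℕ} {ξ : ℕ → ℕ} (hξ : T.ConflictFinder a p ξ)
    {f₀ : ℕ → ℕ} (H : ∀ g, ¬ T.Passes a (interleave f₀ g)) :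
    ∃ γ, Applies (T.exposer a) ξ γ ∧ T.Exposes a p (ofCode _ (γ 0)) := by
  obtain ⟨τ, t, m, e, p', h1, h2⟩ := hξ.exists_not_conflict H
  obtain ⟨M, hM⟩ := h1.eventually (α := ξ) (s := fun z => z)
  let c : (ℕ × ℕ) × (List ℕ × ℕ) × ℕ × ℕ := (p', (τ, t), m, e)
  obtain ⟨γ, h3, m', h4⟩ := applies_search (β := ξ) (w := fun _ => 0) (S := fun l c =>
    T.WrongAnswer a (fun z v => l[z]? = some v) (ofCode ((ℕ × ℕ) × (List ℕ × ℕ) × ℕ × ℕ) c).1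
    (ofCode ((ℕ × ℕ) × (List ℕ × ℕ) × ℕ × ℕ) c).2) ⟨max M (encode c + 1), Or.inl ⟨encode c,
      lt_of_lt_of_le (Nat.lt_succ_self _) (le_max_right _ _), by
        rw [ofCode_encode]
        exact ⟨hM _ (le_max_left _ _), h2⟩⟩⟩
  obtain ⟨h5, h6⟩ := h4.resolve_right (Nat.succ_ne_zero _).symm
  exact ⟨γ, h3, fun hp => hξ.conflict hp (h5.mono fun z v => getElem?_seg_eq_some), h6⟩

end TestSequence

end ConstructiveTruth

namespace ConstructiveTruth

open Encodable

/-! ### Diagonalization -/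

/-- `v` is the value of the `n`-th partial recursive function at `⟨n, z⟩`. -/
def diagonalGraph (n z v : ℕ) : Prop :=
  v ∈ (Denumerable.ofNat Nat.Partrec.Code n).eval (Nat.pair n z)

/-- An index of `α` is also used as the instance of the outer quantifier `∀ n`, whose witness is the
slice `z ↦ α ⟨n, z⟩`. -/
theorem exists_diagonalGraph_iff {α : ℕ → ℕ} (hα : Computable α) :
    ∃ n, ∀ z v, diagonalGraph n z v ↔ α (Nat.pair n z) = v := by
  obtain ⟨c, hc⟩ := Nat.Partrec.Code.exists_code.1 (Partrec.nat_iff.1 hα.partrec)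
  refine ⟨encode c, fun z v => ?_⟩
  rw [diagonalGraph, Denumerable.ofNat_encode, hc]
  exact Part.mem_some_iff.trans eq_comm

theorem arith_diagonalGraph : Arith fun x : ℕ × ℕ × ℕ => diagonalGraph x.1 x.2.1 x.2.2 := by
  have h : Partrec fun x : ℕ × ℕ =>
      (Denumerable.ofNat Nat.Partrec.Code x.1).eval (Nat.pair x.1 x.2) :=
    Nat.Partrec.Code.eval_part.comp ((Primrec.ofNat _).comp Primrec.fst).to_comp
      (Primrec₂.natPair.comp Primrec.fst Primrec.snd).to_comp
  exact (Arith.of_partrec h).comp (f := fun x : ℕ × ℕ × ℕ => ((x.1, x.2.1), x.2.2))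
    ((Primrec.fst.pair (Primrec.fst.comp Primrec.snd)).pair
      (Primrec.snd.comp Primrec.snd)).to_comp

theorem arith_answers_diagonalGraph :
    Arith fun x : ℕ × List ℕ × ℕ => Answers (diagonalGraph x.1) x.2.1 x.2.2 := by
  have h1 := arith_diagonalGraph.comp (f := fun x : ℕ × List ℕ × ℕ =>
    (x.1, encode ((0 : ℕ), x.2.1), x.2.2 + 1)) (Primrec.fst.pair ((primrec_query.comp
      (Primrec.fst.comp Primrec.snd)).pair
        (Primrec.succ.comp (Primrec.snd.comp Primrec.snd)))).to_comp
  have h2 := arith_diagonalGraph.comp (f := fun y : (ℕ × List ℕ × ℕ) × ℕ =>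
    (y.1.1, encode ((0 : ℕ), y.1.2.1.take y.2), 0)) ((Primrec.fst.comp Primrec.fst).pair
      ((primrec_query.comp (Primrec.list_take.comp Primrec.snd
        (Primrec.fst.comp (Primrec.snd.comp Primrec.fst)))).pair (Primrec.const 0))).to_comp
  have h3 : Arith fun y : (ℕ × List ℕ × ℕ) × ℕ => y.2 < y.1.2.1.length :=
    Arith.of_primrecPred (Primrec.nat_lt.comp Primrec.snd (Primrec.list_length.comp
      (Primrec.fst.comp (Primrec.snd.comp Primrec.fst))))
  exact h1.and (Arith.all (P := fun (x : ℕ × List ℕ × ℕ) (k : ℕ) => k < x.2.1.length →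
    diagonalGraph x.1 (encode ((0 : ℕ), x.2.1.take k)) 0) (h3.imp h2))

/-- The pair with least code is chosen, with default `(0, 0)`. The function `u` need not be
recursive; an arithmetical graph is enough for use in content-free matrices. -/
theorem Arith.exists_choice {U : ℕ × ℕ → ℕ × ℕ → Prop}
    (hU : Arith fun x : (ℕ × ℕ) × ℕ × ℕ => U x.1 x.2) : ∃ u : ℕ → ℕ → ℕ × ℕ,
      (Arith fun x : (ℕ × ℕ) × ℕ × ℕ => u x.1.1 x.1.2 = x.2) ∧
      ∀ a n, (∃ p, U (a, n) p) → U (a, n) (u a n) := by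
  classical
  have hdec (x : ℕ × ℕ) : (∃ p, U x p) ↔ ∃ k, U x (Nat.unpair k) :=
    ⟨fun ⟨p, hp⟩ => ⟨Nat.pair p.1 p.2, by simpa using hp⟩, fun ⟨k, hk⟩ => ⟨_, hk⟩⟩
  let u (a n : ℕ) : ℕ × ℕ := if h : ∃ k, U (a, n) (Nat.unpair k) then Nat.unpair (Nat.find h)
    else (0, 0)
  refine ⟨u, ?_, fun a n h => ?_⟩
  · have h1 : Arith fun y : ((ℕ × ℕ) × ℕ × ℕ) × ℕ × ℕ => U y.1.1 y.2 :=
      hU.comp (f := fun y : ((ℕ × ℕ) × ℕ × ℕ) × ℕ × ℕ => (y.1.1, y.2))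
        ((Primrec.fst.comp Primrec.fst).pair Primrec.snd).to_comp
    have h2 : Arith fun y : ((ℕ × ℕ) × ℕ × ℕ) × ℕ × ℕ =>
        Nat.pair y.2.1 y.2.2 < Nat.pair y.1.2.1 y.1.2.2 :=
      Arith.of_primrecPred (Primrec.nat_lt.comp
        (Primrec₂.natPair.comp (Primrec.fst.comp Primrec.snd) (Primrec.snd.comp Primrec.snd))
        (Primrec₂.natPair.comp (Primrec.fst.comp (Primrec.snd.comp Primrec.fst))
          (Primrec.snd.comp (Primrec.snd.comp Primrec.fst))))
    have h3 : Arith fun x : (ℕ × ℕ) × ℕ × ℕ => x.2 = (0, 0) :=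
      Arith.of_primrecPred (Primrec.eq.comp Primrec.snd (Primrec.const _))
    have h4 := Arith.ex (P := fun (x : (ℕ × ℕ) × ℕ × ℕ) (q : ℕ × ℕ) => U x.1 q) h1
    have h5 := Arith.all (P := fun (x : (ℕ × ℕ) × ℕ × ℕ) (q : ℕ × ℕ) =>
      Nat.pair q.1 q.2 < Nat.pair x.2.1 x.2.2 → ¬ U x.1 q) (h2.imp h1.not)
    refine ((hU.and h5).or (h3.and h4.not)).of_iff fun ⟨⟨a, n⟩, p⟩ => ?_
    simp only [u]
    split_ifs with h
    · have h' := (hdec _).2 h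
      simp only [h', not_true, and_false, or_false]
      constructor
      · rintro ⟨hp, hmin⟩
        have : Nat.find h = Nat.pair p.1 p.2 := by
          rw [Nat.find_eq_iff]
          refine ⟨by simpa using hp, fun k hk hk' => hmin (Nat.unpair k) ?_ hk'⟩
          rwa [Nat.pair_unpair]
        rw [this, Nat.unpair_pair]
      · rintro rfl
        refine ⟨Nat.find_spec h, fun q hq hq' => ?_⟩
        rw [Nat.pair_unpair] at hq
        exact Nat.find_min h hq (by simpa using hq')
    · have h' := mt (hdec _).1 h
      simp only [h', not_false_eq_true, and_true]
      constructor
      · rintro (hp | hp)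
        · exact absurd ⟨p, hp.1⟩ h'
        · exact hp.symm
      · exact fun hp => Or.inr hp.symm
  · have h' := (hdec _).1 h
    simp only [u, dif_pos h']
    exact Nat.find_spec h'

namespace TestSequence

variable (T : TestSequence)

/-- The relation diagonalized for `Π¹₂`: entries for which the `n`-th candidate errs on a finite
pair. -/
theorem arith_exists_wrongAnswer : Arith fun x : (ℕ × ℕ) × ℕ × ℕ =>
    ∃ c, T.WrongAnswer x.1.1 (diagonalGraph x.1.2) x.2 c := by
  have ha : Primrec fun y : ((ℕ × ℕ) × ℕ × ℕ) × (List ℕ × ℕ) × ℕ × ℕ => y.1.1.1 :=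
    Primrec.fst.comp (Primrec.fst.comp Primrec.fst)
  have hn : Primrec fun y : ((ℕ × ℕ) × ℕ × ℕ) × (List ℕ × ℕ) × ℕ × ℕ => y.1.1.2 :=
    Primrec.snd.comp (Primrec.fst.comp Primrec.fst)
  have hc : Primrec fun y : ((ℕ × ℕ) × ℕ × ℕ) × (List ℕ × ℕ) × ℕ × ℕ => y.2 := Primrec.snd
  have hm := Primrec.fst.comp (Primrec.snd.comp hc)
  have hs := T.primrec_seg_finitePair.comp (ha.pair ((Primrec.fst.comp hc).pair hm))
  have h1 := arith_answers_diagonalGraph.comp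
    (hn.pair (hs.pair (Primrec.snd.comp (Primrec.snd.comp hc)))).to_comp
  have h2 := Arith.of_primrecPred (T.primrecPred_isWrong.comp
    (ha.pair ((Primrec.snd.comp Primrec.fst).pair hc)))
  exact Arith.ex (P := fun (x : (ℕ × ℕ) × ℕ × ℕ) (c : (List ℕ × ℕ) × ℕ × ℕ) =>
    T.WrongAnswer x.1.1 (diagonalGraph x.1.2) x.2 c) (h1.and h2)

/-- The relation diagonalized for `Σ¹₂`: the entry that the `n`-th candidate names when applied to
the canonical finder, which does not depend on `a`. -/
theorem arith_exposed : Arith fun x : (ℕ × ℕ) × ℕ × ℕ =>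
    ∃ y : ℕ × ℕ, Answers (diagonalGraph x.1.2) (seg T.finder y.1) y.2 ∧
      (ofCode ((ℕ × ℕ) × (List ℕ × ℕ) × ℕ × ℕ) y.2).1 = x.2 := by
  have hn : Primrec fun y : ((ℕ × ℕ) × ℕ × ℕ) × ℕ × ℕ => y.1.1.2 :=
    Primrec.snd.comp (Primrec.fst.comp Primrec.fst)
  have hp : Primrec fun y : ((ℕ × ℕ) × ℕ × ℕ) × ℕ × ℕ => y.1.2 := Primrec.snd.comp Primrec.fst
  have hm : Primrec fun y : ((ℕ × ℕ) × ℕ × ℕ) × ℕ × ℕ => y.2.1 := Primrec.fst.comp Primrec.snd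
  have hc : Primrec fun y : ((ℕ × ℕ) × ℕ × ℕ) × ℕ × ℕ => y.2.2 := Primrec.snd.comp Primrec.snd
  have hs : Primrec fun y : ((ℕ × ℕ) × ℕ × ℕ) × ℕ × ℕ => seg T.finder y.2.1 :=
    (primrec_seg (f := fun _ : Unit => T.finder) (T.primrec_finder.comp Primrec.snd)).comp
      (Primrec.const ()) hm
  have h1 := arith_answers_diagonalGraph.comp (hn.pair (hs.pair hc)).to_comp
  have h2 := Arith.of_primrecPred (Primrec.eq.comp
    (Primrec.fst.comp (primrec_ofCode_answer.comp hc)) hp)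
  exact Arith.ex (P := fun (x : (ℕ × ℕ) × ℕ × ℕ) (y : ℕ × ℕ) =>
    Answers (diagonalGraph x.1.2) (seg T.finder y.1) y.2 ∧
      (ofCode ((ℕ × ℕ) × (List ℕ × ℕ) × ℕ × ℕ) y.2).1 = x.2) (h1.and h2)

end TestSequence

/-! ### The sentences -/

/-- A family of formulas without constructive content that expresses a primitive recursive
relation between the parameter `a`, the pair `u a (e 1)` and the variables `e 2`, `e 3`. -/
theorem exists_family₃ {u : ℕ → ℕ → ℕ × ℕ}
    (hu : Arith fun x : (ℕ × ℕ) × ℕ × ℕ => u x.1.1 x.1.2 = x.2)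
    {Q : ℕ → ℕ × ℕ → ℕ → ℕ → Prop}
    (hQ : PrimrecPred fun x : ℕ × (ℕ × ℕ) × ℕ × ℕ => Q x.1 x.2.1 x.2.2.1 x.2.2.2) :
    ∃ F : ℕ → ArithFormula, (∀ a, (F a).freeVars ⊆ {1, 2, 3}) ∧
      (Computable fun a => (F a).code) ∧
      ∀ a e α, Witnesses (F a) e α ↔ Q a (u a (e 1)) (e 2) (e 3) := by
  have ha : Primrec fun y : (ℕ × ℕ × ℕ × ℕ) × ℕ × ℕ => y.1.1 := Primrec.fst.comp Primrec.fst
  have hn : Primrec fun y : (ℕ × ℕ × ℕ × ℕ) × ℕ × ℕ => y.1.2.1 :=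
    Primrec.fst.comp (Primrec.snd.comp Primrec.fst)
  have hxy : Primrec fun y : (ℕ × ℕ × ℕ × ℕ) × ℕ × ℕ => y.1.2.2 :=
    Primrec.snd.comp (Primrec.snd.comp Primrec.fst)
  have hp : Primrec fun y : (ℕ × ℕ × ℕ × ℕ) × ℕ × ℕ => y.2 := Primrec.snd
  have h1 := hu.comp ((ha.pair hn).pair hp).to_comp
  have h2 := Arith.of_primrecPred (hQ.comp (ha.pair (hp.pair hxy)))
  have h3 := Arith.ex (P := fun (x : ℕ × ℕ × ℕ × ℕ) (p : ℕ × ℕ) =>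
    u x.1 x.2.1 = p ∧ Q x.1 p x.2.2.1 x.2.2.2) (h1.and h2)
  have h4 : Arith fun x : ℕ × ℕ × ℕ × ℕ => Q x.1 (u x.1 x.2.1) x.2.2.1 x.2.2.2 :=
    h3.of_iff fun x => by simp
  refine h4.exists_family {1, 2, 3} fun a e x n hx => ?_
  simp only [Finset.mem_insert, Finset.mem_singleton, not_or] at hx
  simp [Function.update_of_ne (Ne.symm hx.1), Function.update_of_ne (Ne.symm hx.2.1),
    Function.update_of_ne (Ne.symm hx.2.2)]

theorem exists_family₂ {u : ℕ → ℕ → ℕ × ℕ}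
    (hu : Arith fun x : (ℕ × ℕ) × ℕ × ℕ => u x.1.1 x.1.2 = x.2)
    {Q : ℕ → ℕ × ℕ → ℕ → Prop}
    (hQ : PrimrecPred fun x : ℕ × (ℕ × ℕ) × ℕ => Q x.1 x.2.1 x.2.2) :
    ∃ F : ℕ → ArithFormula, (∀ a, (F a).freeVars ⊆ {1, 3}) ∧
      (Computable fun a => (F a).code) ∧
      ∀ a e α, Witnesses (F a) e α ↔ Q a (u a (e 1)) (e 3) := by
  have ha : Primrec fun y : (ℕ × ℕ × ℕ × ℕ) × ℕ × ℕ => y.1.1 := Primrec.fst.comp Primrec.fst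
  have hn : Primrec fun y : (ℕ × ℕ × ℕ × ℕ) × ℕ × ℕ => y.1.2.1 :=
    Primrec.fst.comp (Primrec.snd.comp Primrec.fst)
  have hy : Primrec fun y : (ℕ × ℕ × ℕ × ℕ) × ℕ × ℕ => y.1.2.2.2 :=
    Primrec.snd.comp (Primrec.snd.comp (Primrec.snd.comp Primrec.fst))
  have hp : Primrec fun y : (ℕ × ℕ × ℕ × ℕ) × ℕ × ℕ => y.2 := Primrec.snd
  have h1 := hu.comp ((ha.pair hn).pair hp).to_comp
  have h2 := Arith.of_primrecPred (hQ.comp (ha.pair (hp.pair hy)))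
  have h3 := Arith.ex (P := fun (x : ℕ × ℕ × ℕ × ℕ) (p : ℕ × ℕ) =>
    u x.1 x.2.1 = p ∧ Q x.1 p x.2.2.2) (h1.and h2)
  have h4 : Arith fun x : ℕ × ℕ × ℕ × ℕ => Q x.1 (u x.1 x.2.1) x.2.2.2 :=
    h3.of_iff fun x => by simp
  refine h4.exists_family {1, 3} fun a e x n hx => ?_
  simp only [Finset.mem_insert, Finset.mem_singleton, not_or] at hx
  simp [Function.update_of_ne (Ne.symm hx.1), Function.update_of_ne (Ne.symm hx.2)]

theorem computable_pair_left {f : ℕ → ℕ} (n : ℕ) (hf : Computable f) :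
    Computable fun a => Nat.pair n (f a) :=
  Primrec₂.natPair.to_comp.comp (Computable.const n) hf

theorem computable_pair {f g : ℕ → ℕ} (n : ℕ) (hf : Computable f) (hg : Computable g) :
    Computable fun a => Nat.pair n (Nat.pair (f a) (g a)) :=
  computable_pair_left n (Primrec₂.natPair.to_comp.comp hf hg)

theorem computable_code_imp {A B : ℕ → ArithFormula} (hA : Computable fun a => (A a).code)
    (hB : Computable fun a => (B a).code) : Computable fun a => (Formula.imp (A a) (B a)).code :=
  (computable_pair 5 hA hB).of_eq fun a => by rw [Formula.code]

theorem computable_code_and {A B : ℕ → ArithFormula} (hA : Computable fun a => (A a).code)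
    (hB : Computable fun a => (B a).code) : Computable fun a => (Formula.and (A a) (B a)).code :=
  (computable_pair 3 hA hB).of_eq fun a => by rw [Formula.code]

theorem computable_code_ex {A : ℕ → ArithFormula} (x : ℕ) (hA : Computable fun a => (A a).code) :
    Computable fun a => (Formula.ex x (A a)).code :=
  (computable_pair 6 (Computable.const x) hA).of_eq fun a => by rw [Formula.code]

theorem computable_code_all {A : ℕ → ArithFormula} (x : ℕ) (hA : Computable fun a => (A a).code) :
    Computable fun a => (Formula.all x (A a)).code :=
  (computable_pair 7 (Computable.const x) hA).of_eq fun a => by rw [Formula.code]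

theorem manyOneReducible_of_family {S : Set ℕ} {F : ℕ → ArithFormula}
    (h1 : ∀ a, (F a).freeVars = ∅) (h2 : Computable fun a => (F a).code)
    (h3 : ∀ a, a ∈ S ↔ ConstructivelyTrue (F a)) :
    ManyOneReducible (fun n => n ∈ S) (fun n => n ∈ constructiveArithmeticalTruth) := by
  refine ⟨_, h2, fun a => (h3 a).trans ⟨fun h => ⟨F a, h1 a, h, rfl⟩, ?_⟩⟩
  rintro ⟨φ, -, h, hc⟩
  rwa [Formula.code_injective hc] at h

namespace TestSequence

variable (T : TestSequence)

theorem exists_conflictFinder_family {u : ℕ → ℕ → ℕ × ℕ}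
    (hu : Arith fun x : (ℕ × ℕ) × ℕ × ℕ => u x.1.1 x.1.2 = x.2) :
    ∃ F : ℕ → ArithFormula, (∀ a, (F a).freeVars ⊆ {1}) ∧ (Computable fun a => (F a).code) ∧
      ∀ a e α, Witnesses (F a) e α ↔ T.ConflictFinder a (u a (e 1)) α := by
  have h2 : Primrec fun k : ℕ => 2 * k := Primrec.nat_mul.comp (Primrec.const 2) Primrec.id
  have hx : Primrec fun x : ℕ × (ℕ × ℕ) × ℕ × ℕ => x.2.2.1 :=
    Primrec.fst.comp (Primrec.snd.comp Primrec.snd)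
  have hy : Primrec fun x : ℕ × (ℕ × ℕ) × ℕ × ℕ => x.2.2.2 :=
    Primrec.snd.comp (Primrec.snd.comp Primrec.snd)
  have hp : Primrec fun x : ℕ × (ℕ × ℕ) × ℕ × ℕ => x.2.1 := Primrec.fst.comp Primrec.snd
  have hp' : Primrec fun x : ℕ × (ℕ × ℕ) × ℕ => x.2.1 := Primrec.fst.comp Primrec.snd
  have hy' : Primrec fun x : ℕ × (ℕ × ℕ) × ℕ => x.2.2 := Primrec.snd.comp Primrec.snd
  obtain ⟨A, hA1, hA2, hA3⟩ := exists_family₃ hu (Q := fun _ p x y => p ≠ (2 * x, y))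
    (Primrec.eq.comp hp ((h2.comp hx).pair hy)).not
  obtain ⟨B, hB1, hB2, hB3⟩ := exists_family₃ hu (Q := fun _ p x y => p ≠ (2 * x + 1, y))
    (Primrec.eq.comp hp ((Primrec.succ.comp (h2.comp hx)).pair hy)).not
  obtain ⟨C, hC1, hC2, hC3⟩ := exists_family₂ hu
    (Q := fun a p y => T.LegalRefutation a p (ofCode _ y))
    (T.primrecPred_legalRefutation.comp
      (Primrec.fst.pair (hp'.pair (primrec_ofCode_entries.comp hy'))))
  obtain ⟨D, hD1, hD2, hD3⟩ := exists_family₂ hu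
    (Q := fun a p y => T.Conflict a p (ofCode _ y))
    (T.primrecPred_conflict.comp
      (Primrec.fst.pair (hp'.pair (primrec_ofCode_conflict.comp hy'))))
  -- Variable 1 is the index `n`, 2 an argument and 3 a value. Witnesses of the two formulas `∀ v₂ ∃
  -- v₃` supply the even and the odd part.
  refine ⟨fun a => .imp (.and (.all 2 (.ex 3 (A a))) (.imp (.all 2 (.ex 3 (B a))) (.ex 3 (C a))))
    (.ex 3 (D a)), fun a x => ?_, ?_, fun a e α => ?_⟩
  · have hA := @hA1 a x
    have hB := @hB1 a x
    have hC := @hC1 a x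
    have hD := @hD1 a x
    simp only [Formula.freeVars, Finset.mem_union, Finset.mem_erase, Finset.mem_insert,
      Finset.mem_singleton] at hA hB hC hD ⊢
    clear * - hA hB hC hD
    grind
  · exact computable_code_imp (computable_code_and
      (computable_code_all 2 (computable_code_ex 3 hA2))
      (computable_code_imp (computable_code_all 2 (computable_code_ex 3 hB2))
        (computable_code_ex 3 hC2))) (computable_code_ex 3 hD2)
  · simp only [Witnesses, hA3, hB3, hC3, hD3]
    simp [ConflictFinder, RefuterPair]

theorem exists_pi_family : ∃ F : ℕ → ArithFormula, (∀ a, (F a).freeVars = ∅) ∧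
    (Computable fun a => (F a).code) ∧
    ∀ a, (∀ f, ∃ g, T.Passes a (interleave f g)) ↔ ConstructivelyTrue (F a) := by
  obtain ⟨u, hu, hU⟩ := Arith.exists_choice (U := fun x p =>
    ∃ c, T.WrongAnswer x.1 (diagonalGraph x.2) p c) T.arith_exists_wrongAnswer
  obtain ⟨F, hF1, hF2, hF3⟩ := T.exists_conflictFinder_family hu
  refine ⟨fun a => .all 1 (F a), fun a => ?_,
    computable_code_all 1 hF2, fun a => ?_⟩
  · refine Finset.eq_empty_of_forall_notMem fun x hx => ?_
    have := @hF1 a x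
    simp only [Formula.freeVars, Finset.mem_erase, Finset.mem_singleton] at hx this
    exact hx.1 (this hx.2)
  simp only [ConstructivelyTrue, Witnesses, hF3, Function.update_self]
  constructor
  · intro H
    -- One finder serves every slice because it works for all forbidden entries; so the witness is
    -- recursive even if `u` is not.
    refine ⟨fun k => T.finder k.unpair.2,
      (T.primrec_finder.comp (Primrec.snd.comp Primrec.unpair)).to_comp, fun n => ?_⟩
    simpa using conflictFinder_finder H (u a n)
  · rintro ⟨α, hα, h⟩
    by_contra! H
    obtain ⟨f, hf⟩ := H
    obtain ⟨n, hn⟩ := exists_diagonalGraph_iff hα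
    obtain ⟨τ, t, m, e, p, h1, h2⟩ := (h n).exists_not_conflict hf
    -- Some entry makes slice `n` err, hence `u a n` is such an entry; but this slice is a conflict
    -- finder for `u a n`.
    obtain ⟨c, hc1, hc2, hc3⟩ := hU a n ⟨p, ((τ, t), m, e), h1.mono fun z v => (hn z v).2, h2⟩
    exact hc3 ((h n).conflict hc2 (hc1.mono fun z v => (hn z v).1))

theorem exists_sigma_family : ∃ F : ℕ → ArithFormula, (∀ a, (F a).freeVars = ∅) ∧
    (Computable fun a => (F a).code) ∧
    ∀ a, (¬ ∀ f, ∃ g, T.Passes a (interleave f g)) ↔ ConstructivelyTrue (F a) := by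
  obtain ⟨u, hu, hU⟩ := Arith.exists_choice (U := fun x p => ∃ y : ℕ × ℕ,
    Answers (diagonalGraph x.2) (seg T.finder y.1) y.2 ∧
      (ofCode ((ℕ × ℕ) × (List ℕ × ℕ) × ℕ × ℕ) y.2).1 = p) T.arith_exposed
  obtain ⟨F, hF1, hF2, hF3⟩ := T.exists_conflictFinder_family hu
  obtain ⟨E, hE1, hE2, hE3⟩ := exists_family₂ hu (Q := fun a p y => T.Exposes a p (ofCode _ y))
    (T.primrecPred_exposes.comp (Primrec.fst.pair ((Primrec.fst.comp Primrec.snd).pair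
      (primrec_ofCode_answer.comp (Primrec.snd.comp Primrec.snd)))))
  refine ⟨fun a => .all 1 (.imp (F a) (.ex 3 (E a))), fun a => ?_,
    computable_code_all 1 (computable_code_imp hF2 (computable_code_ex 3 hE2)), fun a => ?_⟩
  · refine Finset.eq_empty_of_forall_notMem fun x hx => ?_
    have hF := @hF1 a x
    have hE := @hE1 a x
    simp only [Formula.freeVars, Finset.mem_erase, Finset.mem_singleton, Finset.mem_union,
      Finset.mem_insert] at hx hF hE
    clear * - hx hF hE
    grind
  simp only [ConstructivelyTrue, Witnesses, hF3, hE3, Function.update_self]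
  have h13 (e : ℕ → ℕ) (n : ℕ) : Function.update e 3 n 1 = e 1 :=
    Function.update_of_ne (by decide) _ _
  simp only [h13, Function.update_self]
  constructor
  · intro H
    push Not at H
    obtain ⟨f, hf⟩ := H
    refine ⟨fun k => T.exposer a k.unpair.2,
      ((T.primrec_exposer a).comp (Primrec.snd.comp Primrec.unpair)).to_comp, fun n ξ hξ => ?_⟩
    simpa using hξ.applies_exposer hf
  · rintro ⟨α, hα, h⟩ H
    obtain ⟨n, hn⟩ := exists_diagonalGraph_iff hα
    obtain ⟨γ, h1, h2⟩ := h n T.finder (conflictFinder_finder H _)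
    obtain ⟨m, hm⟩ := h1.answers
    -- Answers are unique, so `u a n` is the very entry named by `γ 0`, whose conflict would have to
    -- be right and wrong for it.
    obtain ⟨⟨m', c⟩, hc1, hc2⟩ := hU a n ⟨_, (m, γ 0), hm.mono fun z v => (hn z v).2, rfl⟩
    have hc : c = γ 0 := Answers.unique (α := fun k => α (Nat.pair n k))
      (hc1.mono fun z v => (hn z v).1) hm
    simp only [hc] at hc2
    rw [← hc2] at h2
    exact h2.2.2 (h2.1 h2.2.1)

end TestSequence

end ConstructiveTruth

theorem theorem7 :
    ConstructiveTruth.IsHardFor ConstructiveTruth.IsPi12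
      ConstructiveTruth.constructiveArithmeticalTruth ∧
    ConstructiveTruth.IsHardFor ConstructiveTruth.IsSigma12
      ConstructiveTruth.constructiveArithmeticalTruth := by
  constructor
  · rintro S ⟨φ, hφ, hS⟩
    obtain ⟨T, hT⟩ := ConstructiveTruth.exists_testSequence φ hφ
    obtain ⟨F, h1, h2, h3⟩ := T.exists_pi_family
    exact ConstructiveTruth.manyOneReducible_of_family h1 h2 fun a => (hS a).trans ((hT a).trans (h3 a))
  · rintro S ⟨φ, hφ, hS⟩
    -- A `Σ¹₂` statement is the negation of the `Π¹₂` statement with the negated matrix.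
    obtain ⟨T, hT⟩ := ConstructiveTruth.exists_testSequence (.neg φ) hφ
    obtain ⟨F, h1, h2, h3⟩ := T.exists_sigma_family
    refine ConstructiveTruth.manyOneReducible_of_family h1 h2 fun a => ?_
    rw [hS, ← h3, ← hT]
    simp [ConstructiveTruth.Formula.Holds]
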